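/- For $s\in\mathbb{C}$ write $s=\sigma+it$ with $\sigma,t\in\mathbb{R}$. Let $$\mathcal{R}(s)=\int_{0\swarrow1}\frac{x^{-s}e^{\pi i x^2}}{e^{\pi i x}-e^{-\pi i x}}\,dx$$ be Riemann's auxiliary function, where $0\swarrow1$ denotes the line through $\tfrac12$ of slope $1$, run through from the upper right to the lower left, and $x^{-s}$ is the principal branch. Let $\chi(s)=2^s\pi^{s-1}\sin(\pi s/2)\,\Gamma(1-s)$, so that $\zeta(s)=\chi(s)\zeta(1-s)$, and, for $0<\arg(s-1)<2\pi$, let $\eta=\eta(s)=\sqrt{\frac{s-1}{2\pi i}}$ with $-\frac{\pi}{4}<\arg\eta<\frac{3\pi}{4}$. Let $D$ be the set of all $s$ with $1-\sigma>|t|$ and $|s-1|\ge 3528\pi$. Then a point $s\in D$ is a zero of $\mathcal{R}$ if and only if $s=-2n$ for some positive integer $n$. Moreover, there is a continuous function $U\colon D\to\mathbb{C}$ such that for all $s\in D$ $$\mathcal{R}(s)=-\chi(s)\,\eta^{s-1}e^{-\pi i\eta^2}\,\frac{\sqrt2\,e^{3\pi i/8}\sin\pi\eta}{2\cos2\pi\eta}\,\bigl(1+U(s)\bigr),\qquad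 |U(s)|<1,$$ where $\eta^{s-1}$ is the principal branch. -/

import Mathlib

noncomputable section

namespace RiemannAux

open Complex

/-- The point `1/2 + r e^{iπ/4}` of the line of slope one that crosses the real axis at `1/2`. -/
def path (r : ℝ) : ℂ := 1 / 2 + (r : ℂ) * exp (Real.pi * I / 4)

/-- The integrand `x^{-s} e^{πix²} / (e^{πix} - e^{-πix})`, with the principal branch of `x^{-s}`. -/
def integrand (s x : ℂ) : ℂ :=
  x ^ (-s) * exp (Real.pi * I * x ^ 2) / (exp (Real.pi * I * x) - exp (-(Real.pi * I * x)))

/-- Riemann's auxiliary function `R(s) = ∫_{0↙1} x^{-s} e^{πix²} / (e^{πix} - e^{-πix}) dx`.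
The line is run through from the upper right to the lower left, that is, with `r` decreasing
from `+∞` to `-∞`; this accounts for the minus sign. -/
def auxR (s : ℂ) : ℂ :=
  -∫ r : ℝ, integrand s (path r) * exp (Real.pi * I / 4)

/-- The factor `χ(s) = 2^s π^{s-1} sin(πs/2) Γ(1-s)` of the functional equation
`ζ(s) = χ(s) ζ(1-s)`. -/
def chi (s : ℂ) : ℂ :=
  2 ^ s * (Real.pi : ℂ) ^ (s - 1) * sin (Real.pi * s / 2) * Gamma (1 - s)

/-- The square root `η` of `(s-1)/(2πi)` with `-π/4 < arg η < 3π/4`, for `0 < arg (s-1) < 2π`.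
As `(s-1)/(2πi) = i (1-s)/(2π)`, it is `e^{iπ/4}` times the principal root of `(1-s)/(2π)`. -/
def eta (s : ℂ) : ℂ :=
  exp (Real.pi * I / 4) * ((1 - s) / (2 * Real.pi)) ^ (1 / 2 : ℂ)

theorem eta_sq (s : ℂ) : eta s ^ 2 = (s - 1) / (2 * Real.pi * I) := by
  have h1 : exp (Real.pi * I / 4) ^ 2 = I := by
    rw [← exp_nat_mul]
    refine Eq.trans (congrArg exp ?_) exp_pi_div_two_mul_I
    push_cast
    ring
  have h2 : (((1 - s) / (2 * Real.pi)) ^ (1 / 2 : ℂ)) ^ 2 = (1 - s) / (2 * Real.pi) := by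
    rw [one_div]
    exact cpow_nat_inv_pow _ two_ne_zero
  have hpi : (Real.pi : ℂ) ≠ 0 := ofReal_ne_zero.mpr Real.pi_ne_zero
  rw [eta, mul_pow, h1, h2]
  field_simp
  rw [I_sq]
  ring

theorem eta_arg {s : ℂ} (hs : 1 - s ∈ slitPlane) :
    -(Real.pi / 4) < (eta s).arg ∧ (eta s).arg < 3 * Real.pi / 4 := by
  have hpi := Real.pi_pos
  have harg : ((1 - s) / (2 * Real.pi)).arg = (1 - s).arg := by
    have : (1 - s) / (2 * Real.pi) = (((2 * Real.pi)⁻¹ : ℝ) : ℂ) * (1 - s) := by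
      push_cast
      rw [div_eq_mul_inv, mul_comm]
    rw [this, arg_real_mul _ (by positivity)]
  have hne : (1 - s) / (2 * Real.pi) ≠ 0 :=
    div_ne_zero (slitPlane_ne_zero hs) (by simp [Real.pi_ne_zero])
  have h := (mem_slitPlane_iff_arg.mp hs).1
  have hlt : (1 - s).arg < Real.pi := lt_of_le_of_ne (arg_le_pi _) h
  have hgt := neg_pi_lt_arg (1 - s)
  have him : (Real.pi * I / 4 + log ((1 - s) / (2 * Real.pi)) * (1 / 2)).im
      = Real.pi / 4 + (1 - s).arg / 2 := by
    have : Real.pi * I / 4 + log ((1 - s) / (2 * Real.pi)) * (1 / 2)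
        = ((Real.pi / 4 : ℝ) : ℂ) * I + ((1 / 2 : ℝ) : ℂ) * log ((1 - s) / (2 * Real.pi)) := by
      push_cast
      ring
    rw [this, add_im, im_ofReal_mul, im_ofReal_mul, log_im, harg, I_im]
    ring
  have : (eta s).arg = Real.pi / 4 + (1 - s).arg / 2 := by
    rw [eta, cpow_def_of_ne_zero hne, ← exp_add, arg_exp, him, toIocMod_eq_self]
    constructor <;> linarith
  constructor <;> linarith

/-- The region `1 - σ > |t|`, `|s - 1| ≥ 3528π`, where `s = σ + it`. -/
def region : Set ℂ := {s | |s.im| < 1 - s.re ∧ 3528 * Real.pi ≤ ‖s - 1‖}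

/-- The main term
`-χ(s) η^{s-1} e^{-πiη²} √2 e^{3πi/8} sin(πη) / (2 cos(2πη))`. -/
def mainTerm (s : ℂ) : ℂ :=
  -chi s * eta s ^ (s - 1) * exp (-(Real.pi * I * eta s ^ 2)) *
    (((Real.sqrt 2 : ℝ) : ℂ) * exp (3 * Real.pi * I / 8) * sin (Real.pi * eta s) /
      (2 * cos (2 * Real.pi * eta s)))

end RiemannAux

end

/-! Write `ω = e^{πi/4}` and `w = 1 - s`. For `Re s < -1` the factor `x^{-s}` outweighs the simple
pole of the integrand at `0`, so the line of integration may be moved to the parallel through `0`.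
Its two rays carry the same integral with different phases, and together they give `R(s) =
e^{πi(s+1)/4} sin(πs/2) M(w)`, with `M` the Mellin transform of `e^{-πy²}/sin(πωy)`
(`auxR_eq_mellin`). The sine is exact and accounts for the trivial zeros; what remains is to see
that `M(w)` is close to an explicit nonvanishing expression.

On the ray, `1/sin` is a geometric series in odd powers of `e^{πiωy}` (`hasSum_gaussMellin`).
Writing the Gaussian as a Fourier integral turns the `k`-th term into `Γ(w)(2π)^{-w}` times the
integral of `g^{-w} e^{π(g+α)²}` over any vertical line `Re g = c > 0`, where `α = (2k+1)iω/2`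
(`gaussMellin_eq_vertGauss`). With `w = 2πh²`, so that `η = ωh`, the function `g^{-w} e^{πg²}` has
its saddle at `g = h`. The hypotheses on `s` say that `|arg h| < π/8` and `|h| ≥ 42`.

The term `k = 0` gives the leading term with a relative error of order `1/Re h`
(`vertGauss_saddle_zero`). The terms `k ≥ 1` are negligible: for `2k+1 ≤ 2.8|h|` by the line through
the saddle (`norm_vertGauss_saddle_le`), for larger `k` by a line on which the shifted Gaussian has
total mass one (`norm_vertGauss_far_le`). The total relative error is at most `0.4`
(`mellin_kern_eq_leading`).

Finally, with `u = e^{πiη}`, the trigonometric factor `sin πη / (2 cos 2πη)` equals `(i/2) u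
(1-u²)/(1+u⁴)`, and `|u²| ≤ 0.02`. Passing from the leading term to the main term thus keeps the
relative error below `1`. Hence `1 + U` has no zeros, and `R` vanishes exactly where `χ` does. -/

noncomputable section

namespace RiemannAux

open Complex MeasureTheory Filter Topology Set

/-! ### Moving the line of integration to the origin -/

theorem integral_horizontal_shift {g : ℂ → ℂ} {d C : ℝ} (hd : 0 < d)
    (hc : ContinuousOn g {z | -d ≤ z.im ∧ z.im ≤ 0})
    (hdiff : ∀ z : ℂ, -d < z.im → z.im < 0 → DifferentiableAt ℂ g z)
    (hb : ∀ z : ℂ, -d ≤ z.im → z.im ≤ 0 → 1 ≤ |z.re| → ‖g z‖ ≤ C * Real.exp (-|z.re|)) :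
    (∀ y : ℝ, -d ≤ y → y ≤ 0 → Integrable fun r : ℝ => g (r + y * I)) ∧
    ∫ r : ℝ, g (r + (-d : ℝ) * I) = ∫ r : ℝ, g r := by
  have hint : ∀ y : ℝ, -d ≤ y → y ≤ 0 → Integrable fun r : ℝ => g (r + y * I) := by
    intro y hy1 hy2
    have hcont : Continuous fun r : ℝ => g (r + y * I) := by
      rw [← continuousOn_univ]
      refine hc.comp (by fun_prop) ?_
      intro r _
      simp [hy1, hy2]
    refine hcont.locallyIntegrable.integrable_of_isBigO_atBot_atTop
      (g := fun r : ℝ => Real.exp r) (g' := fun r : ℝ => Real.exp (-1 * r)) ?_ ?_ ?_ ?_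
    · refine Asymptotics.IsBigO.of_bound C ?_
      filter_upwards [eventually_le_atBot (-1 : ℝ)] with r hr
      have := hb (r + y * I) (by simpa using hy1) (by simpa using hy2)
        (by simp; rw [abs_of_neg (by linarith)]; linarith)
      simp only [add_re, ofReal_re, mul_re, I_re, mul_zero, ofReal_im, I_im, mul_one, sub_self,
        add_zero] at this
      rw [abs_of_neg (by linarith), neg_neg] at this
      rwa [Real.norm_eq_abs, Real.abs_exp]
    · exact ⟨Iic 0, Iic_mem_atBot 0, integrableOn_exp_Iic 0⟩
    · refine Asymptotics.IsBigO.of_bound C ?_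
      filter_upwards [eventually_ge_atTop (1 : ℝ)] with r hr
      have := hb (r + y * I) (by simpa using hy1) (by simpa using hy2)
        (by simp; rw [abs_of_pos (by linarith)]; linarith)
      simp only [add_re, ofReal_re, mul_re, I_re, mul_zero, ofReal_im, I_im, mul_one, sub_self,
        add_zero] at this
      rw [abs_of_pos (by linarith)] at this
      rwa [Real.norm_eq_abs, Real.abs_exp, neg_one_mul]
    · exact ⟨Ioi 0, Ioi_mem_atTop 0, exp_neg_integrableOn_Ioi 0 one_pos⟩
  refine ⟨hint, ?_⟩
  have hI : ∀ y : ℝ, -d ≤ y → y ≤ 0 → Tendsto (fun T : ℝ => ∫ r in (-T)..T, g (r + y * I)) atTop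
      (𝓝 (∫ r : ℝ, g (r + y * I))) := fun y h1 h2 =>
    intervalIntegral_tendsto_integral (hint y h1 h2) tendsto_neg_atTop_atBot tendsto_id
  have hC : Tendsto (fun T : ℝ => C * Real.exp (-T) * |0 - -d|) atTop (𝓝 0) := by
    have := (Real.tendsto_exp_neg_atTop_nhds_zero.const_mul C).mul_const |0 - -d|
    simpa using this
  have hside : ∀ e : ℝ, |e| = 1 → Tendsto (fun T : ℝ => ∫ y in (-d)..0, g ((e * T : ℝ) + y * I))
      atTop (𝓝 0) := by
    intro e he
    refine squeeze_zero_norm' ?_ hC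
    filter_upwards [eventually_ge_atTop (1 : ℝ)] with T hT
    refine intervalIntegral.norm_integral_le_of_norm_le_const ?_
    intro y hy
    rw [uIoc_of_le (by linarith)] at hy
    have habs : |e * T| = T := by rw [abs_mul, he, one_mul, abs_of_pos (by linarith)]
    have := hb ((e * T : ℝ) + y * I) (by simpa using hy.1.le) (by simpa using hy.2)
    simp only [add_re, ofReal_re, mul_re, I_re, mul_zero, ofReal_im, I_im, mul_one, sub_self,
        add_zero] at this
    rw [habs] at this
    exact this hT
  have hrect : ∀ T : ℝ, 0 < T → ((∫ r in (-T)..T, g (r + (-d : ℝ) * I)) -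
      ∫ r in (-T)..T, g (r + (0 : ℝ) * I)) + I • (∫ y in (-d)..0, g ((1 * T : ℝ) + y * I)) -
      I • (∫ y in (-d)..0, g (((-1) * T : ℝ) + y * I)) = 0 := by
    intro T hT
    have := Complex.integral_boundary_rect_eq_zero_of_continuousOn_of_differentiableOn g
      (⟨-T, -d⟩ : ℂ) (⟨T, 0⟩ : ℂ) ?_ ?_
    · simpa only [one_mul, neg_one_mul] using this
    · refine hc.mono ?_
      intro z hz
      have := hz.2
      simp only [mem_preimage, uIcc_of_le (show -d ≤ 0 by linarith)] at this
      exact this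
    · intro z hz
      have := hz.2
      simp only [mem_preimage, min_eq_left (show -d ≤ 0 by linarith),
        max_eq_right (show -d ≤ 0 by linarith)] at this
      exact (hdiff z this.1 this.2).differentiableWithinAt
  have hlim := (((hI (-d) le_rfl (by linarith)).sub (hI 0 (by linarith) le_rfl)).add
    ((hside 1 (by simp)).const_smul I)).sub ((hside (-1) (by simp)).const_smul I)
  have h0 := tendsto_nhds_unique (hlim.congr' (by
    filter_upwards [eventually_gt_atTop (0 : ℝ)] with T hT using hrect T hT)) tendsto_const_nhds
  simp only [smul_zero, add_zero, sub_zero] at h0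
  have h1 := sub_eq_zero.mp h0
  simpa using h1

/-- The eighth root of unity `e^{πi/4}`. -/
def om : ℂ := exp (Real.pi * I / 4)

theorem om_eq : om = (Real.sqrt 2 / 2 : ℝ) + (Real.sqrt 2 / 2 : ℝ) * I := by
  have : (Real.pi * I / 4 : ℂ) = ((Real.pi / 4 : ℝ) : ℂ) * I := by push_cast; ring
  rw [om, this, exp_mul_I, ← ofReal_cos, ← ofReal_sin, Real.cos_pi_div_four, Real.sin_pi_div_four]

theorem om_re : om.re = Real.sqrt 2 / 2 := by
  rw [om_eq]; simp [-ofReal_div]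

theorem om_im : om.im = Real.sqrt 2 / 2 := by
  rw [om_eq]; simp [-ofReal_div]

theorem om_ne_zero : om ≠ 0 := exp_ne_zero _

theorem norm_om : ‖om‖ = 1 := by
  have : (Real.pi * I / 4 : ℂ) = ((Real.pi / 4 : ℝ) : ℂ) * I := by push_cast; ring
  rw [om, this, norm_exp_ofReal_mul_I]

theorem om_sq : om ^ 2 = I := by
  rw [om, ← exp_nat_mul]
  refine Eq.trans (congrArg exp ?_) exp_pi_div_two_mul_I
  push_cast
  ring

theorem om_mul_re (z : ℂ) : (om * z).re = Real.sqrt 2 / 2 * (z.re - z.im) := by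
  rw [mul_re, om_re, om_im]; ring

theorem om_mul_im (z : ℂ) : (om * z).im = Real.sqrt 2 / 2 * (z.re + z.im) := by
  rw [mul_im, om_re, om_im]; ring

theorem exp_sub_exp_eq_zero_iff (x : ℂ) :
    exp (Real.pi * I * x) - exp (-(Real.pi * I * x)) = 0 ↔ ∃ n : ℤ, x = n := by
  rw [sub_eq_zero, exp_eq_exp_iff_exists_int]
  have hpi : (Real.pi : ℂ) ≠ 0 := ofReal_ne_zero.mpr Real.pi_ne_zero
  have hpI : (2 * Real.pi * I : ℂ) ≠ 0 := by simp [hpi]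
  refine exists_congr fun n => ?_
  constructor
  · intro h
    apply mul_left_cancel₀ hpI
    linear_combination h
  · rintro rfl
    ring

/-- Away from `0` the integrand is `x^{-s-1}`, which tends to `0`, times `e^{πix²}` and the inverse
difference quotient of the denominator, which tends to `1/(2πi)`. The limit `0` agrees with the
value that division by zero assigns at `0`. -/
theorem continuousAt_integrand_zero {s : ℂ} (hs : s.re < -1) : ContinuousAt (integrand s) 0 := by
  have h0 : integrand s 0 = 0 := by simp [integrand]
  rw [continuousAt_iff_punctured_nhds, h0]
  have hpi : (Real.pi : ℂ) ≠ 0 := ofReal_ne_zero.mpr Real.pi_ne_zero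
  have hd : HasDerivAt (fun x : ℂ => exp (Real.pi * I * x) - exp (-(Real.pi * I * x)))
      (2 * Real.pi * I) 0 := by
    have h1 : HasDerivAt (fun x : ℂ => Real.pi * I * x) (Real.pi * I) 0 := by
      simpa using (hasDerivAt_id (0 : ℂ)).const_mul (Real.pi * I : ℂ)
    have := h1.cexp.sub h1.neg.cexp
    refine this.congr_deriv ?_
    simp
    ring
  have hsl := (hasDerivAt_iff_tendsto_slope.mp hd).inv₀ (by simp [hpi])
  have h1 : Tendsto (fun x : ℂ => x ^ (-s - 1)) (𝓝[≠] 0) (𝓝 0) := by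
    have hre : 0 < (-s - 1).re := by simp; linarith
    have := (continuousAt_cpow_zero_of_re_pos hre).tendsto.comp
      (show Tendsto (fun x : ℂ => (x, -s - 1)) (𝓝[≠] 0) (𝓝 (0, -s - 1)) from
        (tendsto_nhdsWithin_of_tendsto_nhds tendsto_id).prodMk_nhds tendsto_const_nhds)
    simpa [Function.comp_def, zero_cpow (show -s - 1 ≠ 0 from fun h => by simp [h] at hre)] using this
  have h2 : Tendsto (fun x : ℂ => exp (Real.pi * I * x ^ 2)) (𝓝[≠] 0) (𝓝 1) := by
    have : Continuous fun x : ℂ => exp (Real.pi * I * x ^ 2) := by fun_prop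
    have := tendsto_nhdsWithin_of_tendsto_nhds (s := {0}ᶜ) (this.tendsto 0)
    simpa using this
  have h3 := (h1.mul h2).mul hsl
  rw [zero_mul, zero_mul] at h3
  refine h3.congr' ?_
  filter_upwards [self_mem_nhdsWithin] with x hx
  have hx : x ≠ 0 := hx
  rw [slope_def_field, integrand, cpow_sub _ _ hx, cpow_one]
  simp only [mul_zero, neg_zero, sub_self, sub_zero, exp_zero, inv_div]
  field_simp

/-- Up to the rotation by `e^{πi/4}`, the integrand is holomorphic on the closed strip between the line
of integration and its parallel through `0`, except at `0`. -/
theorem differentiableAt_integrand_om {s z : ℂ} (h1 : -(Real.sqrt 2 / 4) ≤ z.im) (h2 : z.im ≤ 0)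
    (hz : z ≠ 0) : DifferentiableAt ℂ (fun z => integrand s (om * z)) z := by
  have hs2 : 0 < Real.sqrt 2 := by positivity
  have hsq : Real.sqrt 2 ^ 2 = 2 := Real.sq_sqrt (by norm_num)
  have hslit : om * z ∈ slitPlane := by
    rw [mem_slitPlane_iff, om_mul_re, om_mul_im]
    by_contra! hcon
    obtain ⟨ha, hb⟩ := hcon
    have hb' : z.re + z.im = 0 := by
      rcases mul_eq_zero.mp hb with h | h
      · linarith
      · exact h
    have : z.re - z.im ≤ 0 := by
      by_contra! h
      have := mul_pos (half_pos hs2) h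
      linarith
    apply hz
    apply Complex.ext <;> simp <;> linarith
  have hden : exp (Real.pi * I * (om * z)) - exp (-(Real.pi * I * (om * z))) ≠ 0 := by
    intro h
    obtain ⟨n, hn⟩ := (exp_sub_exp_eq_zero_iff _).mp h
    have hr := congrArg Complex.re hn
    have hi := congrArg Complex.im hn
    rw [om_mul_re, intCast_re] at hr
    rw [om_mul_im, intCast_im] at hi
    have hb' : z.re + z.im = 0 := by
      rcases mul_eq_zero.mp hi with h | h
      · linarith
      · exact h
    have hn' : (n : ℝ) = - Real.sqrt 2 * z.im := by
      rw [← hr]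
      linear_combination (Real.sqrt 2 / 2) * hb'
    have hn0 : (0 : ℝ) ≤ n := by rw [hn']; nlinarith
    have hn1 : (n : ℝ) < 1 := by rw [hn']; nlinarith
    have : n = 0 := by
      have h0 : 0 ≤ n := by exact_mod_cast hn0
      have h1 : n < 1 := by exact_mod_cast hn1
      omega
    rw [this, Int.cast_zero, mul_eq_zero] at hn
    exact hn.elim om_ne_zero hz
  unfold integrand
  refine DifferentiableAt.div ?_ (by fun_prop) hden
  refine DifferentiableAt.mul ?_ (by fun_prop)
  exact DifferentiableAt.cpow (by fun_prop) (by fun_prop) hslit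

/-- In the rotated variable `e^{πix²}` becomes `e^{-πz²}`, which beats the polynomial growth of the
power, while the denominator stays at least `1` once `|Re z| ≥ 1`. -/
theorem norm_integrand_om_le (s : ℂ) : ∃ C : ℝ, ∀ z : ℂ, -(Real.sqrt 2 / 4) ≤ z.im → z.im ≤ 0 →
    1 ≤ |z.re| → ‖integrand s (om * z)‖ ≤ C * Real.exp (-|z.re|) := by
  obtain ⟨k, hk⟩ := exists_nat_ge (-s.re)
  refine ⟨k.factorial * Real.exp 1 * Real.exp (Real.pi * |s.im|) * Real.exp Real.pi, ?_⟩
  intro z h1 h2 h3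
  have hpi := Real.pi_pos
  have hpi3 := Real.pi_gt_three
  have hs2 : 1.4 < Real.sqrt 2 := Real.lt_sqrt_of_sq_lt (by norm_num)
  have hs2' : Real.sqrt 2 < 1.42 := by rw [Real.sqrt_lt' (by norm_num)]; norm_num
  have hz1 : |z.re| ≤ ‖z‖ := abs_re_le_norm z
  have hz2 : ‖z‖ ≤ 1 + |z.re| := by
    have := norm_le_abs_re_add_abs_im z
    have h4 : |z.im| ≤ 1 := by rw [abs_le]; constructor <;> linarith
    linarith
  have hx : ‖om * z‖ = ‖z‖ := by rw [norm_mul, norm_om, one_mul]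
  have hpow : ‖(om * z) ^ (-s)‖ ≤
      k.factorial * Real.exp (1 + |z.re|) * Real.exp (Real.pi * |s.im|) := by
    refine (norm_cpow_le _ _).trans ?_
    rw [div_eq_mul_inv, ← Real.exp_neg, hx]
    refine mul_le_mul ?_ ?_ (Real.exp_pos _).le (by positivity)
    · calc ‖z‖ ^ (-s).re ≤ ‖z‖ ^ (k : ℝ) :=
            Real.rpow_le_rpow_of_exponent_le (by linarith) (by simpa using hk)
        _ = ‖z‖ ^ k := Real.rpow_natCast _ _
        _ ≤ (1 + |z.re|) ^ k := by gcongr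
        _ ≤ k.factorial * Real.exp (1 + |z.re|) := by
            have := Real.pow_div_factorial_le_exp (1 + |z.re|) (by positivity) k
            rwa [div_le_iff₀ (by positivity), mul_comm] at this
    · apply Real.exp_le_exp.mpr
      rw [neg_im, mul_neg, neg_neg]
      calc (om * z).arg * s.im ≤ |(om * z).arg * s.im| := le_abs_self _
        _ = |(om * z).arg| * |s.im| := abs_mul _ _
        _ ≤ Real.pi * |s.im| := by gcongr; exact abs_arg_le_pi _
  have hexp : ‖exp (Real.pi * I * (om * z) ^ 2)‖ ≤ Real.exp (Real.pi - Real.pi * |z.re|) := by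
    rw [norm_exp]
    apply Real.exp_le_exp.mpr
    have : (Real.pi * I * (om * z) ^ 2 : ℂ) = ((-Real.pi : ℝ) : ℂ) * z ^ 2 := by
      rw [mul_pow, om_sq]
      push_cast
      linear_combination (Real.pi * z ^ 2 : ℂ) * I_sq
    rw [this, re_ofReal_mul, pow_two, mul_re]
    have h5 : |z.re| ≤ z.re * z.re := by
      rw [← abs_mul_abs_self z.re]; nlinarith
    have h6 : z.im * z.im ≤ 1 := by nlinarith
    nlinarith
  have hden : 1 ≤ ‖exp (Real.pi * I * (om * z)) - exp (-(Real.pi * I * (om * z)))‖ := by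
    have hre : (Real.pi * I * (om * z) : ℂ).re = -(Real.pi * (om * z).im) := by
      rw [mul_assoc, re_ofReal_mul, I_mul_re]; ring
    have hge : ∀ A B : ℂ, |‖A‖ - ‖B‖| ≤ ‖A - B‖ := abs_norm_sub_norm_le
    refine le_trans ?_ (hge _ _)
    rw [norm_exp, norm_exp, neg_re, hre, neg_neg, om_mul_im]
    set t := Real.pi * (Real.sqrt 2 / 2 * (z.re + z.im)) with ht
    have htabs : 1 ≤ |t| := by
      rw [ht, abs_mul, abs_mul, abs_of_pos hpi, abs_of_pos (by linarith : 0 < Real.sqrt 2 / 2)]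
      have : (0.6 : ℝ) ≤ |z.re + z.im| := by
        have := abs_sub_abs_le_abs_add z.re z.im
        have h4 : |z.im| ≤ 0.4 := by rw [abs_le]; constructor <;> linarith
        linarith
      have : 0.7 * 0.6 ≤ Real.sqrt 2 / 2 * |z.re + z.im| :=
        mul_le_mul (by linarith) this (by norm_num) (by linarith)
      nlinarith
    rcases le_or_gt 0 t with h | h
    · rw [abs_of_nonneg h] at htabs
      rw [abs_sub_comm]
      refine le_trans ?_ (le_abs_self _)
      have := Real.add_one_le_exp t
      have h7 : Real.exp (-t) ≤ 1 := Real.exp_le_one_iff.mpr (by linarith)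
      linarith
    · rw [abs_of_neg h] at htabs
      refine le_trans ?_ (le_abs_self _)
      have := Real.add_one_le_exp (-t)
      have h7 : Real.exp t ≤ 1 := Real.exp_le_one_iff.mpr (by linarith)
      linarith
  rw [integrand, norm_div, norm_mul]
  refine (div_le_self (by positivity) hden).trans ?_
  refine (mul_le_mul hpow hexp (norm_nonneg _) (by positivity)).trans ?_
  have : Real.exp (1 + |z.re|) * Real.exp (Real.pi - Real.pi * |z.re|) ≤
      Real.exp 1 * Real.exp Real.pi * Real.exp (-|z.re|) := by
    rw [← Real.exp_add, ← Real.exp_add, ← Real.exp_add]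
    apply Real.exp_le_exp.mpr
    nlinarith
  calc _ = k.factorial * Real.exp (Real.pi * |s.im|) *
        (Real.exp (1 + |z.re|) * Real.exp (Real.pi - Real.pi * |z.re|)) := by ring
    _ ≤ k.factorial * Real.exp (Real.pi * |s.im|) *
        (Real.exp 1 * Real.exp Real.pi * Real.exp (-|z.re|)) := by gcongr
    _ = _ := by ring

theorem auxR_eq_integral_om {s : ℂ} (hs : s.re < -1) :
    (Integrable fun r : ℝ => integrand s (om * r)) ∧
    auxR s = -(om * ∫ r : ℝ, integrand s (om * r)) := by
  obtain ⟨C, hC⟩ := norm_integrand_om_le s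
  have hsq : Real.sqrt 2 * Real.sqrt 2 = 2 := Real.mul_self_sqrt (by norm_num)
  -- `1/2 = ω(√2/4 - i√2/4)`: in the rotated variable the original line lies at height `-√2/4`, and
  -- its parameter is displaced by `√2/4`.
  have key := integral_horizontal_shift (g := fun z => integrand s (om * z))
    (d := Real.sqrt 2 / 4) (C := C) (by positivity) ?_ ?_ hC
  · refine ⟨by simpa using key.1 0 (by simp; positivity) le_rfl, ?_⟩
    rw [← key.2, auxR, integral_mul_const, mul_comm om,
      ← integral_add_right_eq_self
        (fun r : ℝ => integrand s (om * (r + (-(Real.sqrt 2 / 4) : ℝ) * I))) (Real.sqrt 2 / 4)]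
    congr 2
    refine integral_congr_ae (Eventually.of_forall fun r => ?_)
    change integrand s (path r) = integrand s _
    congr 1
    rw [path, ← om]
    push_cast
    rw [om_eq]
    push_cast
    linear_combination (-1 / 4 : ℂ) * (by exact_mod_cast hsq : (Real.sqrt 2 : ℂ) * Real.sqrt 2 = 2)
      + (1 / 8 : ℂ) * (Real.sqrt 2 : ℂ) ^ 2 * I_sq
  · intro z hz
    -- The only bad point `0` lies on the upper edge of the strip, where continuity is enough.
    rcases eq_or_ne z 0 with rfl | h
    · have h0 : ContinuousAt (integrand s) (om * 0) := by
        rw [mul_zero]; exact continuousAt_integrand_zero hs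
      exact (ContinuousAt.comp (f := fun z => om * z) h0 (by fun_prop)).continuousWithinAt
    · exact (differentiableAt_integrand_om hz.1 hz.2 h).continuousAt.continuousWithinAt
  · intro z h1 h2
    exact differentiableAt_integrand_om h1.le h2.le (by rintro rfl; simp at h2)

/-! ### Reduction to a Mellin transform -/

/-- `e^{-πy²} / sin(π e^{πi/4} y)`, the integrand on the line through `0` without its power. -/
def kern (y : ℝ) : ℂ := exp (-(Real.pi * (y : ℂ) ^ 2)) / sin (Real.pi * om * y)

theorem integrand_om_eq (s : ℂ) (x : ℂ) :
    integrand s (om * x) = (om * x) ^ (-s) * exp (-(Real.pi * x ^ 2)) /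
      (2 * I * sin (Real.pi * om * x)) := by
  have h1 : (Real.pi * I * (om * x) ^ 2 : ℂ) = -(Real.pi * x ^ 2) := by
    rw [mul_pow, om_sq]
    linear_combination (Real.pi * x ^ 2 : ℂ) * I_sq
  have h2 : 2 * I * sin (Real.pi * om * x) =
      exp (Real.pi * I * (om * x)) - exp (-(Real.pi * I * (om * x))) := by
    rw [sin, show -(Real.pi * om * x) * I = -(Real.pi * I * (om * x)) by ring,
      show (Real.pi * om * x) * I = Real.pi * I * (om * x) by ring]
    linear_combination (exp (-(Real.pi * I * (om * x))) - exp (Real.pi * I * (om * x))) * I_sq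
  rw [integrand, h1, h2]

theorem om_mul_cpow {y : ℝ} (hy : 0 < y) (s : ℂ) :
    (om * y) ^ (-s) = exp (-(Real.pi * I * s / 4)) * (y : ℂ) ^ (-s) := by
  have hy' : (y : ℂ) ≠ 0 := ofReal_ne_zero.mpr hy.ne'
  have hl : log (om * y) = Real.log y + (Real.pi / 4 : ℝ) * I := by
    rw [mul_comm, log_ofReal_mul hy om_ne_zero, om,
      show (Real.pi * I / 4 : ℂ) = ((Real.pi / 4 : ℝ) : ℂ) * I by push_cast; ring, log_exp] <;>
    simp only [mul_im, ofReal_re, I_im, ofReal_im, I_re] <;> linarith [Real.pi_pos]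
  rw [cpow_def_of_ne_zero (mul_ne_zero om_ne_zero hy'), hl, cpow_def_of_ne_zero hy', ← exp_add,
    ofReal_log hy.le]
  congr 1
  push_cast
  ring

/-- The principal argument of `-ωy` is `-3π/4`, not `5π/4`; this fixes the phase on the lower ray.
-/
theorem om_mul_neg_cpow {y : ℝ} (hy : 0 < y) (s : ℂ) :
    (om * (-y : ℝ)) ^ (-s) = exp (3 * Real.pi * I * s / 4) * (y : ℂ) ^ (-s) := by
  have hy' : (y : ℂ) ≠ 0 := ofReal_ne_zero.mpr hy.ne'
  have hneg : (om * (-y : ℝ)) = (y : ℂ) * exp (((-(3 * Real.pi / 4) : ℝ) : ℂ) * I) := by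
    have : om = -exp (((-(3 * Real.pi / 4) : ℝ) : ℂ) * I) := by
      rw [om, show (Real.pi * I / 4 : ℂ) =
        ((-(3 * Real.pi / 4) : ℝ) : ℂ) * I + Real.pi * I by push_cast; ring, exp_add, exp_pi_mul_I]
      ring
    rw [this]
    push_cast
    ring
  have hl : log (om * (-y : ℝ)) = Real.log y + (-(3 * Real.pi / 4) : ℝ) * I := by
    rw [hneg, log_ofReal_mul hy (exp_ne_zero _), log_exp] <;>
    simp only [mul_im, ofReal_re, I_im, ofReal_im, I_re] <;> linarith [Real.pi_pos]
  rw [cpow_def_of_ne_zero (by rw [hneg]; exact mul_ne_zero hy' (exp_ne_zero _)), hl,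
    cpow_def_of_ne_zero hy', ← exp_add, ofReal_log hy.le]
  congr 1
  push_cast
  ring

/-- Relative to `e^{πis/4}` the rays carry the phases `e^{-πis/2}` and `e^{πis/2}`. The oddness of
the kernel's sine gives them opposite signs, so they combine into `sin(πs/2)`. -/
theorem auxR_eq_mellin {s : ℂ} (hs : s.re < -1) :
    auxR s = exp (Real.pi * I * (s + 1) / 4) * sin (Real.pi * s / 2) * mellin kern (1 - s) := by
  obtain ⟨hint, heq⟩ := auxR_eq_integral_om hs
  rw [heq, ← intervalIntegral.integral_Iic_add_Ioi (b := 0) hint.integrableOn hint.integrableOn]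
  have h1 : ∫ r : ℝ in Iic 0, integrand s (om * r) =
      ∫ r : ℝ in Ioi 0, integrand s (om * ((-r : ℝ) : ℂ)) := by
    rw [integral_comp_neg_Ioi (0 : ℝ) (fun r : ℝ => integrand s (om * (r : ℂ))), neg_zero]
  have h2 : ∫ r : ℝ in Iic 0, integrand s (om * r) =
      (-exp (3 * Real.pi * I * s / 4) / (2 * I)) * mellin kern (1 - s) := by
    rw [h1, mellin, ← integral_const_mul]
    refine setIntegral_congr_fun measurableSet_Ioi fun y hy => ?_
    rw [integrand_om_eq, om_mul_neg_cpow hy, kern, smul_eq_mul,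
      show (1 - s - 1 : ℂ) = -s by ring]
    push_cast
    rw [mul_neg, sin_neg, neg_sq]
    ring
  have h3 : ∫ r : ℝ in Ioi 0, integrand s (om * r) =
      (exp (-(Real.pi * I * s / 4)) / (2 * I)) * mellin kern (1 - s) := by
    rw [mellin, ← integral_const_mul]
    refine setIntegral_congr_fun measurableSet_Ioi fun y hy => ?_
    rw [integrand_om_eq, om_mul_cpow hy, kern, smul_eq_mul,
      show (1 - s - 1 : ℂ) = -s by ring]
    ring
  rw [h2, h3, sin, om, show (Real.pi * I * (s + 1) / 4 : ℂ) =
    Real.pi * I / 4 + Real.pi * I * s / 4 by ring, exp_add,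
    show (3 * Real.pi * I * s / 4 : ℂ) = Real.pi * I * s / 4 + Real.pi * s / 2 * I by ring, exp_add,
    show (-(Real.pi * I * s / 4) : ℂ) = Real.pi * I * s / 4 + -(Real.pi * s / 2) * I by ring,
    exp_add]
  have hI : (I : ℂ) ≠ 0 := I_ne_zero
  field_simp
  rw [I_sq]
  ring

/-! ### Laplace transforms and Gaussian integrals over vertical lines -/

theorem integrableOn_rpow_mul_exp_neg {W b : ℝ} (hW : 0 < W) (hb : 0 < b) :
    IntegrableOn (fun y : ℝ => y ^ (W - 1) * Real.exp (-(b * y))) (Ioi 0) := by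
  have := integrableOn_rpow_mul_exp_neg_mul_rpow (p := 1) (s := W - 1) (b := b) (by linarith)
    one_pos hb
  simpa using this

theorem aestronglyMeasurable_cpow_mul {w : ℂ} {g : ℝ → ℂ} (hg : Continuous g) :
    AEStronglyMeasurable (fun y : ℝ => (y : ℂ) ^ (w - 1) * g y) (volume.restrict (Ioi 0)) := by
  refine ContinuousOn.aestronglyMeasurable ?_ measurableSet_Ioi
  refine ContinuousOn.mul ?_ hg.continuousOn
  intro y hy
  exact (continuousAt_ofReal_cpow_const y _ (Or.inr (ne_of_gt hy))).continuousWithinAt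

theorem integrableOn_cpow_mul_of_le {w : ℂ} {b C : ℝ} {g : ℝ → ℂ} (hw : 0 < w.re) (hb : 0 < b)
    (hg : Continuous g) (h : ∀ y : ℝ, 0 < y → ‖g y‖ ≤ C * Real.exp (-(b * y))) :
    IntegrableOn (fun y : ℝ => (y : ℂ) ^ (w - 1) * g y) (Ioi 0) := by
  refine Integrable.mono' ((integrableOn_rpow_mul_exp_neg hw hb).const_mul C)
    (aestronglyMeasurable_cpow_mul hg) ?_
  refine (ae_restrict_iff' measurableSet_Ioi).mpr (Eventually.of_forall fun y hy => ?_)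
  rw [norm_mul, norm_cpow_eq_rpow_re_of_pos hy, sub_re, one_re]
  have hy' : 0 ≤ y ^ (w.re - 1) := Real.rpow_nonneg (le_of_lt hy) _
  calc _ ≤ y ^ (w.re - 1) * (C * Real.exp (-(b * y))) := by gcongr; exact h y hy
    _ = _ := by ring

theorem norm_exp_neg_mul_ofReal (p : ℂ) (y : ℝ) :
    ‖exp (-(p * y))‖ = Real.exp (-(p.re * y)) := by
  rw [norm_exp, neg_re, re_mul_ofReal]

theorem integrableOn_cpow_mul_exp_neg {w p : ℂ} (hw : 0 < w.re) (hp : 0 < p.re) :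
    IntegrableOn (fun y : ℝ => (y : ℂ) ^ (w - 1) * exp (-(p * y))) (Ioi 0) := by
  refine integrableOn_cpow_mul_of_le (C := 1) hw hp (by fun_prop) fun y _ => ?_
  rw [norm_exp_neg_mul_ofReal, one_mul]

/-- The Laplace transform of a power, for a complex parameter. -/
theorem integral_cpow_mul_exp_neg_mul_complex {w p : ℂ} (hw : 0 < w.re) (hp : 0 < p.re) :
    ∫ y : ℝ in Ioi 0, (y : ℂ) ^ (w - 1) * exp (-(p * y)) = Gamma w * p ^ (-w) := by
  have hopen : IsOpen {z : ℂ | 0 < z.re} := isOpen_lt continuous_const continuous_re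
  have hconv : IsPreconnected {z : ℂ | 0 < z.re} := (convex_halfSpace_re_gt 0).isPreconnected
  have hF : DifferentiableOn ℂ (fun p : ℂ => ∫ y : ℝ in Ioi 0, (y : ℂ) ^ (w - 1) * exp (-(p * y)))
      {z | 0 < z.re} := by
    intro q hq
    have hq : 0 < q.re := hq
    refine DifferentiableAt.differentiableWithinAt ?_
    have hball : ∀ z ∈ Metric.ball q (q.re / 2), q.re / 2 ≤ z.re := by
      intro z hz
      have h1 := (abs_re_le_norm (z - q)).trans_lt (mem_ball_iff_norm.mp hz)
      rw [sub_re, abs_lt] at h1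
      linarith [h1.1]
    refine (hasDerivAt_integral_of_dominated_loc_of_deriv_le
      (F' := fun (z : ℂ) (y : ℝ) => (y : ℂ) ^ (w - 1) * (exp (-(z * y)) * -(y : ℂ)))
      (bound := fun y : ℝ => y ^ (w.re + 1 - 1) * Real.exp (-(q.re / 2 * y)))
      (Metric.ball_mem_nhds q (half_pos hq)) ?_ ?_ ?_ ?_ ?_ ?_).2.differentiableAt
    · exact Eventually.of_forall fun z => aestronglyMeasurable_cpow_mul (by fun_prop)
    · exact integrableOn_cpow_mul_exp_neg hw hq
    · exact aestronglyMeasurable_cpow_mul (by fun_prop)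
    · refine (ae_restrict_iff' measurableSet_Ioi).mpr (Eventually.of_forall fun y hy z hz => ?_)
      have hy : 0 < y := hy
      rw [norm_mul, norm_mul, norm_cpow_eq_rpow_re_of_pos hy, sub_re, one_re,
        norm_exp_neg_mul_ofReal, norm_neg, norm_real, Real.norm_of_nonneg hy.le,
        add_sub_cancel_right, show y ^ w.re = y ^ (w.re - 1) * y by
          rw [← Real.rpow_add_one hy.ne', sub_add_cancel], mul_assoc, mul_comm (Real.exp _)]
      have := hball z hz
      gcongr
    · exact integrableOn_rpow_mul_exp_neg (by linarith) (half_pos hq)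
    · refine Eventually.of_forall fun y z _ => ?_
      have h1 : HasDerivAt (fun z : ℂ => -(z * y)) (-(y : ℂ)) z := by
        have := ((hasDerivAt_id z).mul_const (y : ℂ)).neg
        rw [one_mul] at this
        exact this
      exact h1.cexp.const_mul _
  have hG : DifferentiableOn ℂ (fun p : ℂ => Gamma w * p ^ (-w)) {z | 0 < z.re} := by
    intro q hq
    refine DifferentiableAt.differentiableWithinAt ?_
    exact (DifferentiableAt.cpow differentiableAt_id (by fun_prop)
      (Or.inl hq : q ∈ slitPlane)).const_mul _
  -- Identity theorem: both sides are holomorphic for `Re p > 0` and agree at positive real `p`,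
  -- which accumulate at `1`.
  refine (hF.analyticOnNhd hopen).eqOn_of_preconnected_of_frequently_eq (hG.analyticOnNhd hopen)
    hconv (z₀ := 1) (by simp) ?_ hp
  have hmap : Tendsto (fun t : ℝ => (t : ℂ)) (𝓝[≠] 1) (𝓝[≠] 1) := by
    refine tendsto_nhdsWithin_iff.mpr ⟨?_, ?_⟩
    · have := continuous_ofReal.tendsto 1
      rw [ofReal_one] at this
      exact tendsto_nhdsWithin_of_tendsto_nhds this
    · filter_upwards [self_mem_nhdsWithin] with t ht
      intro h
      exact ht (by simpa using h)
  refine hmap.frequently (Eventually.frequently ?_)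
  have : ∀ᶠ t : ℝ in 𝓝 1, 0 < t := lt_mem_nhds one_pos
  filter_upwards [mem_nhdsWithin_of_mem_nhds this] with t ht
  have ht' : (t : ℂ).arg ≠ Real.pi := by
    rw [arg_ofReal_of_nonneg (le_of_lt ht)]
    exact Real.pi_ne_zero.symm
  rw [Complex.integral_cpow_mul_exp_neg_mul_Ioi hw ht, one_div, inv_cpow _ _ ht', cpow_neg, mul_comm]

/-- The integral `∫₀^∞ y^{w-1} e^{-πy²+2παy} dy`. -/
def gaussMellin (w α : ℂ) : ℂ :=
  ∫ y : ℝ in Ioi 0, (y : ℂ) ^ (w - 1) * exp (-(Real.pi * (y : ℂ) ^ 2) + 2 * Real.pi * α * y)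

/-- The integral of `g^{-w} e^{π(g+α)²}` over the vertical line with abscissa `c`. -/
def vertGauss (c : ℝ) (w α : ℂ) : ℂ :=
  ∫ r : ℝ, (c + r * I : ℂ) ^ (-w) * exp (Real.pi * (c + r * I + α) ^ 2)

theorem norm_vertGauss_integrand (c : ℝ) (α : ℂ) (r : ℝ) :
    ‖exp (Real.pi * (c + r * I + α) ^ 2)‖ =
      Real.exp (Real.pi * (c + α.re) ^ 2) * Real.exp (-Real.pi * (r + α.im) ^ 2) := by
  rw [norm_exp, ← Real.exp_add]
  congr 1
  rw [re_ofReal_mul, pow_two, mul_re]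
  simp
  ring

theorem integrable_exp_vert (c : ℝ) (α : ℂ) :
    Integrable fun r : ℝ => exp (Real.pi * (c + r * I + α) ^ 2) := by
  have := integrable_cexp_quadratic (b := Real.pi) (by simpa using Real.pi_pos)
    (2 * Real.pi * I * (c + α)) (Real.pi * (c + α) ^ 2)
  refine this.congr (Eventually.of_forall fun r => ?_)
  simp only
  congr 1
  linear_combination (-(Real.pi * r ^ 2) : ℂ) * I_sq

theorem integral_exp_vert (c : ℝ) (α : ℂ) (y : ℝ) :
    ∫ r : ℝ, exp (Real.pi * (c + r * I + α) ^ 2) * exp (-(2 * Real.pi * (c + r * I) * y)) =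
      exp (-(Real.pi * (y : ℂ) ^ 2) + 2 * Real.pi * α * y) := by
  have hpi : (Real.pi : ℂ) ≠ 0 := ofReal_ne_zero.mpr Real.pi_ne_zero
  have := integral_cexp_quadratic (b := -Real.pi) (by simpa using Real.pi_pos)
    (2 * Real.pi * I * (c + α - y)) (Real.pi * (c + α) ^ 2 - 2 * Real.pi * c * y)
  rw [neg_neg, div_self hpi, one_cpow, one_mul] at this
  refine Eq.trans (integral_congr_ae (Eventually.of_forall fun r => ?_)) (this.trans ?_)
  · simp only
    rw [← exp_add]
    congr 1
    linear_combination (Real.pi * r ^ 2 : ℂ) * I_sq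
  · congr 1
    field_simp
    rw [I_sq]
    ring

/-- The Gaussian is the integral of `e^{π(g+α)²} e^{-2πgy}` over the line `Re g = c`. By Fubini the
`y`-integral becomes the Laplace transform of a power at `2πg`. -/
theorem gaussMellin_eq_vertGauss {w : ℂ} (hw : 0 < w.re) (α : ℂ) {c : ℝ} (hc : 0 < c) :
    gaussMellin w α = Gamma w * (2 * Real.pi : ℂ) ^ (-w) * vertGauss c w α := by
  have hpi := Real.pi_pos
  -- The coupling factor `e^{-2πiry}` is unimodular; the rest is a product of integrable functions
  -- of `r` and of `y`.
  have hint : Integrable (Function.uncurry fun (r y : ℝ) =>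
      exp (-(2 * Real.pi * r * y) * I) * (exp (Real.pi * (c + r * I + α) ^ 2) *
        ((y : ℂ) ^ (w - 1) * exp (-(2 * Real.pi * c * y)))))
      ((volume : Measure ℝ).prod (volume.restrict (Ioi 0))) := by
    have hp : (0 : ℝ) < (2 * Real.pi * c : ℂ).re := by
      rw [show (2 * Real.pi * c : ℂ) = ((2 * Real.pi * c : ℝ) : ℂ) by push_cast; ring, ofReal_re]
      positivity
    refine Integrable.bdd_mul (c := 1)
      ((integrable_exp_vert c α).mul_prod (integrableOn_cpow_mul_exp_neg hw hp)) ?_ ?_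
    · exact Continuous.aestronglyMeasurable (by fun_prop)
    · refine Eventually.of_forall fun z => ?_
      rw [show (-(2 * Real.pi * z.1 * z.2) * I : ℂ) =
        ((-(2 * Real.pi * z.1 * z.2) : ℝ) : ℂ) * I by push_cast; ring, norm_exp_ofReal_mul_I]
  have hswap := integral_integral_swap hint
  have hexp : ∀ r y : ℝ, exp (-(2 * Real.pi * r * y) * I) * exp (-(2 * Real.pi * c * y)) =
      exp (-(2 * Real.pi * (c + r * I) * y)) := by
    intro r y
    rw [← exp_add]
    congr 1
    ring
  have hR : ∫ y : ℝ in Ioi 0, ∫ r : ℝ,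
      exp (-(2 * Real.pi * r * y) * I) * (exp (Real.pi * (c + r * I + α) ^ 2) *
        ((y : ℂ) ^ (w - 1) * exp (-(2 * Real.pi * c * y)))) = gaussMellin w α := by
    refine setIntegral_congr_fun measurableSet_Ioi fun y _ => ?_
    rw [← integral_exp_vert c α y, ← integral_const_mul]
    refine integral_congr_ae (Eventually.of_forall fun r => ?_)
    simp only
    rw [← hexp]
    ring
  have hL : ∀ r : ℝ, ∫ y : ℝ in Ioi 0,
      exp (-(2 * Real.pi * r * y) * I) * (exp (Real.pi * (c + r * I + α) ^ 2) *
        ((y : ℂ) ^ (w - 1) * exp (-(2 * Real.pi * c * y)))) =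
      Gamma w * (2 * Real.pi : ℂ) ^ (-w) *
        ((c + r * I : ℂ) ^ (-w) * exp (Real.pi * (c + r * I + α) ^ 2)) := by
    intro r
    have hcr : (c + r * I : ℂ) ∈ slitPlane := Or.inl (by simpa using hc)
    have hre : 0 < (2 * Real.pi * (c + r * I) : ℂ).re := by
      rw [show (2 * Real.pi * (c + r * I) : ℂ) = ((2 * Real.pi : ℝ) : ℂ) * (c + r * I) by
        push_cast; ring, re_ofReal_mul]
      simp
      positivity
    have hsplit : (2 * Real.pi * (c + r * I) : ℂ) ^ (-w) =
        (2 * Real.pi : ℂ) ^ (-w) * (c + r * I : ℂ) ^ (-w) := by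
      have h2 : (2 * Real.pi : ℂ) = ((2 * Real.pi : ℝ) : ℂ) := by push_cast; ring
      have hne := slitPlane_ne_zero hcr
      rw [cpow_def_of_ne_zero (by rw [h2]; exact mul_ne_zero (ofReal_ne_zero.mpr (by positivity)) hne),
        h2, log_ofReal_mul (by positivity) hne, cpow_def_of_ne_zero (ofReal_ne_zero.mpr
        (by positivity)), cpow_def_of_ne_zero hne, ← exp_add, ofReal_log (by positivity)]
      ring_nf
    have := integral_cpow_mul_exp_neg_mul_complex hw hre
    rw [hsplit] at this
    rw [show Gamma w * (2 * Real.pi : ℂ) ^ (-w) *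
        ((c + r * I : ℂ) ^ (-w) * exp (Real.pi * (c + r * I + α) ^ 2)) =
        exp (Real.pi * (c + r * I + α) ^ 2) *
        (Gamma w * ((2 * Real.pi : ℂ) ^ (-w) * (c + r * I : ℂ) ^ (-w))) by ring, ← this,
      ← integral_const_mul]
    refine setIntegral_congr_fun measurableSet_Ioi fun y _ => ?_
    rw [← hexp]
    ring
  rw [← hR, ← hswap, vertGauss, ← integral_const_mul]
  exact integral_congr_ae (Eventually.of_forall fun r => hL r)

/-- With `u = e^{πiωy}`, `|u| < 1`, one has `(i/2)/sin(πωy) = u/(1-u²)`, the sum of the `u^{2k+1}`.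
The `k`-th term has `L¹` norm at most `Γ(Re w)(k+1)^{-Re w}`, so `Re w > 1` allows termwise
integration. -/
theorem hasSum_gaussMellin {w : ℂ} (hw : 1 < w.re) :
    HasSum (fun k : ℕ => gaussMellin w ((2 * k + 1) * (I * om / 2))) (I / 2 * mellin kern w) := by
  have hpi := Real.pi_pos
  have hs2 : 0 < Real.sqrt 2 := by positivity
  set b : ℕ → ℝ := fun k => (2 * k + 1) * (Real.pi * (Real.sqrt 2 / 2)) with hb
  have hbpos : ∀ k, 0 < b k := fun k => by simp only [hb]; positivity
  set F : ℕ → ℝ → ℂ := fun k y => (y : ℂ) ^ (w - 1) *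
    exp (-(Real.pi * (y : ℂ) ^ 2) + 2 * Real.pi * ((2 * k + 1) * (I * om / 2)) * y) with hF
  have hnorm : ∀ (k : ℕ) (y : ℝ), 0 < y → ‖exp (-(Real.pi * (y : ℂ) ^ 2) +
      2 * Real.pi * ((2 * k + 1) * (I * om / 2)) * y)‖ ≤ 1 * Real.exp (-(b k * y)) := by
    intro k y hy
    rw [norm_exp, one_mul]
    apply Real.exp_le_exp.mpr
    rw [show (-(Real.pi * (y : ℂ) ^ 2) + 2 * Real.pi * ((2 * k + 1) * (I * om / 2)) * y : ℂ) =
      ((-(Real.pi * y ^ 2) : ℝ) : ℂ) + (((2 * k + 1) * Real.pi * y : ℝ) : ℂ) * (I * om) by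
        push_cast; ring, add_re, ofReal_re, re_ofReal_mul, I_mul_re, om_im]
    have : 0 ≤ Real.pi * y ^ 2 := by positivity
    simp only [hb]
    nlinarith
  have hint : ∀ k, Integrable (F k) (volume.restrict (Ioi 0)) := fun k =>
    integrableOn_cpow_mul_of_le (by linarith) (hbpos k) (by fun_prop) (hnorm k)
  have hbound : ∀ k, ∫ y : ℝ in Ioi 0, ‖F k y‖ ≤ (1 / ((k + 1 : ℕ) : ℝ) ^ w.re) * Real.Gamma w.re := by
    intro k
    calc ∫ y : ℝ in Ioi 0, ‖F k y‖ ≤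
          ∫ y : ℝ in Ioi 0, y ^ (w.re - 1) * Real.exp (-(b k * y)) := by
          refine setIntegral_mono_on (hint k).norm
            (integrableOn_rpow_mul_exp_neg (by linarith) (hbpos k)) measurableSet_Ioi ?_
          intro y hy
          have hy' : 0 ≤ y ^ (w.re - 1) := Real.rpow_nonneg (le_of_lt hy) _
          simp only [hF]
          rw [norm_mul, norm_cpow_eq_rpow_re_of_pos hy, sub_re, one_re]
          gcongr
          simpa using hnorm k y hy
      _ = (1 / b k) ^ w.re * Real.Gamma w.re :=
          Real.integral_rpow_mul_exp_neg_mul_Ioi (by linarith) (hbpos k)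
      _ ≤ _ := by
          have hG : 0 ≤ Real.Gamma w.re := (Real.Gamma_pos_of_pos (by linarith)).le
          rw [one_div, Real.inv_rpow (hbpos k).le, ← one_div]
          have : ((k + 1 : ℕ) : ℝ) ≤ b k := by
            simp only [hb]
            have h1 : 1 ≤ Real.pi * (Real.sqrt 2 / 2) := by
              have : 1 ≤ Real.sqrt 2 := Real.one_le_sqrt.mpr (by norm_num)
              nlinarith [Real.pi_gt_three]
            push_cast
            have hk : (0 : ℝ) ≤ k := k.cast_nonneg
            nlinarith
          gcongr
  have hsum : Summable fun k => ∫ y : ℝ in Ioi 0, ‖F k y‖ := by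
    refine Summable.of_nonneg_of_le (fun k => integral_nonneg fun y => norm_nonneg _) hbound ?_
    exact ((summable_nat_add_iff 1).mpr (Real.summable_one_div_nat_rpow.mpr hw)).mul_right _
  have key := hasSum_integral_of_summable_integral_norm hint hsum
  suffices heq : I / 2 * mellin kern w = ∫ y : ℝ in Ioi 0, ∑' k, F k y by
    rw [heq]
    exact key
  rw [mellin, ← integral_const_mul]
  refine setIntegral_congr_fun measurableSet_Ioi fun y hy => ?_
  have hy : 0 < y := hy
  set u := exp (Real.pi * I * om * y) with hu
  have hu0 : u ≠ 0 := exp_ne_zero _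
  have hu1 : ‖u‖ < 1 := by
    rw [hu, norm_exp, show (Real.pi * I * om * y : ℂ) = ((Real.pi * y : ℝ) : ℂ) * (I * om) by
      push_cast; ring, re_ofReal_mul, I_mul_re, om_im, Real.exp_lt_one_iff]
    have : 0 < Real.pi * y * (Real.sqrt 2 / 2) := by positivity
    linarith
  have hu2 : ‖u ^ 2‖ < 1 := by
    rw [norm_pow]
    exact pow_lt_one₀ (norm_nonneg _) hu1 two_ne_zero
  have hterm : ∀ k, F k y = (y : ℂ) ^ (w - 1) * exp (-(Real.pi * (y : ℂ) ^ 2)) * u * (u ^ 2) ^ k := by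
    intro k
    simp only [hF]
    have : exp (-(Real.pi * (y : ℂ) ^ 2) + 2 * Real.pi * ((2 * k + 1) * (I * om / 2)) * y) =
        exp (-(Real.pi * (y : ℂ) ^ 2)) * u * (u ^ 2) ^ k := by
      rw [hu, ← exp_nat_mul, ← exp_nat_mul, ← exp_add, ← exp_add]
      congr 1
      push_cast
      ring
    rw [this]
    ring
  have hsin : sin (Real.pi * om * y) = (u⁻¹ - u) * I / 2 := by
    rw [sin, hu, ← exp_neg]
    ring_nf
  have h1 : (1 - u ^ 2) ≠ 0 := by
    intro h
    rw [← sub_eq_zero.mp h] at hu2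
    simp at hu2
  have hd : u⁻¹ - u = (1 - u ^ 2) * u⁻¹ := by field_simp
  simp_rw [hterm]
  rw [tsum_mul_left, tsum_geometric_of_norm_lt_one hu2, kern, hsin, smul_eq_mul, hd]
  have hI : (I : ℂ) ≠ 0 := I_ne_zero
  field_simp

/-! ### Estimates on the vertical line through the saddle point -/

theorem integrable_exp_neg_sq_add {β : ℝ} (hβ : 0 < β) (γ : ℝ) :
    Integrable fun r : ℝ => Real.exp (-β * r ^ 2 - γ * r) := by
  have h := ((integrable_exp_neg_mul_sq hβ).comp_add_right (γ / (2 * β))).const_mul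
    (Real.exp (γ ^ 2 / (4 * β)))
  refine h.congr (Eventually.of_forall fun r => ?_)
  simp only
  rw [← Real.exp_add]
  congr 1
  field_simp
  ring

theorem integral_exp_neg_sq_add {β : ℝ} (hβ : 0 < β) (γ : ℝ) :
    ∫ r : ℝ, Real.exp (-β * r ^ 2 - γ * r) =
      Real.sqrt (Real.pi / β) * Real.exp (γ ^ 2 / (4 * β)) := by
  rw [← integral_gaussian β, ← integral_add_right_eq_self
    (fun r : ℝ => Real.exp (-β * r ^ 2)) (γ / (2 * β)), ← integral_mul_const]
  refine integral_congr_ae (Eventually.of_forall fun r => ?_)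
  simp only
  rw [← Real.exp_add]
  congr 1
  field_simp
  ring

theorem norm_exp_sub_exp_le (z w : ℂ) {B : ℝ} (hz : z.re ≤ B) (hw : w.re ≤ B) :
    ‖exp z - exp w‖ ≤ Real.exp B * ‖z - w‖ := by
  refine Convex.norm_image_sub_le_of_norm_hasDerivWithin_le (s := {z : ℂ | z.re ≤ B})
    (f' := exp) (fun x _ => (hasDerivAt_exp x).hasDerivWithinAt) ?_ (convex_halfSpace_re_le B) hw hz
  intro x hx
  rw [norm_exp]
  exact Real.exp_le_exp.mpr hx

/-- The exponent `-w log(g/h) + π(g² - h²)` at the point `g = h + ir`, where `w = 2πh²`. -/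
def expo (h : ℂ) (r : ℝ) : ℂ :=
  -(2 * Real.pi * h ^ 2) * log (h + r * I) + Real.pi * (h + r * I) ^ 2 +
    (2 * Real.pi * h ^ 2) * log h - Real.pi * h ^ 2

theorem add_mul_I_mem_slitPlane {h : ℂ} (ha : 0 < h.re) (r : ℝ) : h + r * I ∈ slitPlane :=
  Or.inl (by simpa using ha)

theorem hasDerivAt_expo {h : ℂ} (ha : 0 < h.re) (r : ℝ) :
    HasDerivAt (expo h) (-(2 * Real.pi * r) * (1 + h / (h + r * I))) r := by
  have hne := slitPlane_ne_zero (add_mul_I_mem_slitPlane ha r)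
  have h1 : HasDerivAt (fun r : ℝ => h + r * I) I r := by
    simpa using ((hasDerivAt_id r).ofReal_comp.mul_const I).const_add h
  have h2 := h1.clog_real (add_mul_I_mem_slitPlane ha r)
  have h3 := ((((h2.const_mul (-(2 * Real.pi * h ^ 2))).add
    ((h1.pow 2).const_mul (Real.pi : ℂ))).add_const
      ((2 * Real.pi * h ^ 2) * log h)).sub_const (Real.pi * h ^ 2))
  refine h3.congr_deriv ?_
  have e : I * ((h + r * I) ^ 2 - h ^ 2) = -r * ((h + r * I) + h) := by
    linear_combination (2 * h * r + r ^ 2 * I : ℂ) * I_sq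
  generalize h + r * I = g at hne e ⊢
  have e' : I * g ^ 2 - I * h ^ 2 = -r * (g + h) := by rw [← e]; ring
  simp only [Nat.add_one_sub_one, pow_one]
  field_simp
  push_cast
  linear_combination 2 * e'

theorem expo_zero (h : ℂ) : expo h 0 = 0 := by
  simp [expo]

theorem re_one_add_div_ge {h : ℂ} (ha : 0 < h.re) (hb : h.im ^ 2 ≤ 0.18 * h.re ^ 2) (r : ℝ) :
    0.95 ≤ (1 + h / (h + r * I)).re := by
  have hn : 0 < normSq (h + r * I) :=
    normSq_pos.mpr (slitPlane_ne_zero (add_mul_I_mem_slitPlane ha r))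
  rw [add_re, one_re, div_re, ← add_div, ← sub_le_iff_le_add', le_div_iff₀ hn, normSq_apply]
  simp
  -- With `t = Im h + r` the claim is `1.05 a² + bt + 0.05 t² ≥ 0`, where `h = a + ib`. Completing
  -- the square as `0.05(t + 10b)²` leaves `1.05 a² - 5b²`, which is nonnegative since `5 · 0.18 <
  -- 1.05`.
  nlinarith [sq_nonneg (h.im + r + 10 * h.im)]

/-- The derivative `-2πr(1 + h/(h+ir))` of the exponent has a controlled real part: it pulls towards
the saddle at least as strongly as that of `-0.95πr²`. -/
theorem re_expo_le {h : ℂ} (ha : 0 < h.re) (hb : h.im ^ 2 ≤ 0.18 * h.re ^ 2) (r : ℝ) :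
    (expo h r).re ≤ -(0.95 * Real.pi) * r ^ 2 := by
  have hd : ∀ t : ℝ, HasDerivAt (fun t : ℝ => (expo h (r * t)).re + 0.95 * Real.pi * (r * t) ^ 2)
      (-(2 * Real.pi * r ^ 2 * t) * ((1 + h / (h + (r * t : ℝ) * I)).re - 0.95)) t := by
    intro t
    have h0 : HasDerivAt (fun t : ℝ => r * t) r t := by
      simpa using (hasDerivAt_id t).const_mul r
    have h1 := (hasDerivAt_expo ha (r * t)).scomp t h0
    have h2 := (reCLM.hasFDerivAt.comp_hasDerivAt t h1).add
      ((h0.pow 2).const_mul (0.95 * Real.pi))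
    refine h2.congr_deriv ?_
    rw [reCLM_apply, real_smul, show (-(2 * Real.pi * ((r * t : ℝ) : ℂ)) : ℂ) =
      ((-(2 * Real.pi * (r * t)) : ℝ) : ℂ) by push_cast; ring, re_ofReal_mul, re_ofReal_mul]
    push_cast
    ring
  have hanti : AntitoneOn (fun t : ℝ => (expo h (r * t)).re + 0.95 * Real.pi * (r * t) ^ 2)
      (Ici 0) := by
    refine antitoneOn_of_hasDerivWithinAt_nonpos (convex_Ici 0)
      (fun t _ => (hd t).continuousAt.continuousWithinAt)
      (fun t _ => (hd t).hasDerivWithinAt) ?_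
    intro t ht
    rw [interior_Ici] at ht
    have ht : 0 < t := ht
    have h1 := re_one_add_div_ge ha hb (r * t)
    have h2 : 0 ≤ 2 * Real.pi * r ^ 2 * t := by positivity
    nlinarith
  have := hanti (mem_Ici.mpr le_rfl) (mem_Ici.mpr zero_le_one) zero_le_one
  simp only [mul_zero, mul_one, expo_zero, zero_re] at this
  linarith

/-- Taylor remainder at the saddle: along `t ↦ rt` the derivative of the difference is `2πi
r³t²/(h+irt)`, and `|h+irt| ≥ Re h`. -/
theorem norm_expo_add_le {h : ℂ} (ha : 0 < h.re) (r : ℝ) :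
    ‖expo h r + 2 * Real.pi * r ^ 2‖ ≤ 2 * Real.pi / (3 * h.re) * |r| ^ 3 := by
  have hd : ∀ t : ℝ, HasDerivAt (fun t : ℝ => expo h (r * t) + 2 * Real.pi * (r * t : ℝ) ^ 2)
      (2 * Real.pi * r ^ 3 * t ^ 2 * I / (h + (r * t : ℝ) * I)) t := by
    intro t
    have hne := slitPlane_ne_zero (add_mul_I_mem_slitPlane ha (r * t))
    have h0 : HasDerivAt (fun t : ℝ => r * t) r t := by
      simpa using (hasDerivAt_id t).const_mul r
    have h1 := (hasDerivAt_expo ha (r * t)).scomp t h0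
    have h2 := h1.add ((h0.ofReal_comp.pow 2).const_mul (2 * Real.pi : ℂ))
    refine h2.congr_deriv ?_
    rw [real_smul]
    field_simp
    push_cast
    ring
  have key := image_norm_le_of_norm_deriv_right_le_deriv_boundary (a := 0) (b := 1)
    (B := fun t => 2 * Real.pi / (3 * h.re) * |r| ^ 3 * t ^ 3)
    (B' := fun t => 2 * Real.pi / (3 * h.re) * |r| ^ 3 * (3 * t ^ 2))
    (fun t _ => (hd t).continuousAt.continuousWithinAt)
    (fun t _ => (hd t).hasDerivWithinAt) (by simp [expo_zero])
    (fun t => by simpa using (hasDerivAt_pow 3 t).const_mul (2 * Real.pi / (3 * h.re) * |r| ^ 3))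
    ?_ (right_mem_Icc.mpr zero_le_one)
  · simpa using key
  · intro t ht
    have hg : h.re ≤ ‖h + (r * t : ℝ) * I‖ := by
      refine le_trans (le_of_eq ?_) (re_le_norm _)
      rw [add_re, re_ofReal_mul, I_re, mul_zero, add_zero]
    rw [norm_div, norm_mul, norm_I, mul_one,
      show (2 * Real.pi * r ^ 3 * t ^ 2 : ℂ) = ((2 * Real.pi * r ^ 3 * t ^ 2 : ℝ) : ℂ) by push_cast; ring,
      norm_real, Real.norm_eq_abs, abs_mul, abs_mul, abs_pow, abs_of_pos Real.two_pi_pos,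
      abs_of_nonneg (sq_nonneg t)]
    calc _ ≤ 2 * Real.pi * |r| ^ 3 * t ^ 2 / h.re := by gcongr
      _ = _ := by field_simp

theorem cpow_mul_exp_eq_expo {h : ℂ} (ha : 0 < h.re) (r : ℝ) :
    (h + r * I) ^ (-(2 * Real.pi * h ^ 2)) * exp (Real.pi * (h + r * I) ^ 2) =
      h ^ (-(2 * Real.pi * h ^ 2)) * exp (Real.pi * h ^ 2) * exp (expo h r) := by
  have hne := slitPlane_ne_zero (add_mul_I_mem_slitPlane ha r)
  have hne' : h ≠ 0 := by rintro rfl; simp at ha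
  rw [cpow_def_of_ne_zero hne, cpow_def_of_ne_zero hne', ← exp_add, ← exp_add, ← exp_add, expo]
  congr 1
  ring

theorem vertGauss_eq_expo {h : ℂ} (ha : 0 < h.re) (α : ℂ) :
    vertGauss h.re (2 * Real.pi * h ^ 2) α =
      h ^ (-(2 * Real.pi * h ^ 2)) * exp (Real.pi * h ^ 2) *
        exp (Real.pi * α ^ 2 + 2 * Real.pi * h * α) *
        ∫ r : ℝ, exp (expo h r + 2 * Real.pi * α * I * r) := by
  rw [vertGauss, ← integral_add_right_eq_self _ h.im, ← integral_const_mul]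
  refine integral_congr_ae (Eventually.of_forall fun r => ?_)
  simp only
  have hz : (h.re : ℂ) + (r + h.im : ℝ) * I = h + r * I := by
    nth_rewrite 3 [← re_add_im h]
    push_cast
    ring
  rw [hz, show (Real.pi * (h + r * I + α) ^ 2 : ℂ) = Real.pi * (h + r * I) ^ 2 +
    (Real.pi * α ^ 2 + 2 * Real.pi * h * α + 2 * Real.pi * α * I * r) by ring, exp_add,
    ← mul_assoc, cpow_mul_exp_eq_expo ha, exp_add, exp_add (expo h r)]
  ring

/-- The value `h^{-w} e^{πh²}`, `w = 2πh²`, at the saddle point. -/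
def saddle (h : ℂ) : ℂ := h ^ (-(2 * Real.pi * h ^ 2)) * exp (Real.pi * h ^ 2)

/-- For `α = (2k+1)iω/2` one has `πα² = -πi(2k+1)²/4`. Odd squares are `1` modulo `8`, so this phase
does not depend on `k`. -/
theorem exp_odd_shift (h : ℂ) (k : ℕ) :
    exp (Real.pi * ((2 * k + 1) * (I * om / 2)) ^ 2 + 2 * Real.pi * h * ((2 * k + 1) * (I * om / 2))) =
      exp (-(Real.pi * I / 4)) * exp ((2 * k + 1) * (Real.pi * I * (om * h))) := by
  obtain ⟨j, hj⟩ := Nat.even_mul_succ_self k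
  have hj' : (k : ℂ) * (k + 1) = j + j := by exact_mod_cast hj
  rw [← exp_add, exp_eq_exp_iff_exists_int]
  refine ⟨-j, ?_⟩
  push_cast
  linear_combination (Real.pi * (2 * k + 1) ^ 2 / 4 * om ^ 2 : ℂ) * I_sq -
    (Real.pi * (2 * k + 1) ^ 2 / 4 : ℂ) * om_sq - Real.pi * I * hj'

theorem shift_mul (k : ℕ) (r : ℝ) :
    2 * Real.pi * ((2 * k + 1) * (I * om / 2)) * I * r =
      (((-((2 * k + 1) * Real.pi * r)) : ℝ) : ℂ) * om := by
  push_cast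
  linear_combination (Real.pi * (2 * k + 1) * om * r : ℂ) * I_sq

theorem continuous_expo {h : ℂ} (ha : 0 < h.re) : Continuous (expo h) :=
  continuous_iff_continuousAt.mpr fun r => (hasDerivAt_expo ha r).continuousAt

theorem norm_vertGauss_saddle_le {h : ℂ} (ha : 0 < h.re) (hb : h.im ^ 2 ≤ 0.18 * h.re ^ 2) (k : ℕ) :
    ‖vertGauss h.re (2 * Real.pi * h ^ 2) ((2 * k + 1) * (I * om / 2))‖ ≤
      ‖saddle h‖ * (1.03 * Real.exp (Real.pi * ((2 * k + 1) ^ 2 / 7.6 - (2 * k + 1) * (om * h).im))) := by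
  have hpi := Real.pi_pos
  have hsq : Real.sqrt 2 ^ 2 = 2 := Real.sq_sqrt (by norm_num)
  rw [vertGauss_eq_expo ha, exp_odd_shift, ← saddle, norm_mul, norm_mul, norm_mul, mul_assoc]
  refine mul_le_mul_of_nonneg_left ?_ (norm_nonneg _)
  have h1 : ‖exp (-(Real.pi * I / 4))‖ = 1 := by
    rw [show (-(Real.pi * I / 4) : ℂ) = ((-(Real.pi / 4) : ℝ) : ℂ) * I by push_cast; ring,
      norm_exp_ofReal_mul_I]
  have h2 : ‖exp ((2 * k + 1) * (Real.pi * I * (om * h)))‖ =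
      Real.exp (-((2 * k + 1) * Real.pi * (om * h).im)) := by
    rw [norm_exp, show ((2 * k + 1) * (Real.pi * I * (om * h)) : ℂ) =
      (((2 * k + 1) * Real.pi : ℝ) : ℂ) * (I * (om * h)) by push_cast; ring, re_ofReal_mul, I_mul_re]
    congr 1
    ring
  have h3 : ‖∫ r : ℝ, exp (expo h r + 2 * Real.pi * ((2 * k + 1) * (I * om / 2)) * I * r)‖ ≤
      1.03 * Real.exp (Real.pi * ((2 * k + 1) ^ 2 / 7.6)) := by
    have hβ : 0 < 0.95 * Real.pi := by positivity
    refine (norm_integral_le_of_norm_le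
      (integrable_exp_neg_sq_add hβ ((2 * k + 1) * Real.pi * (Real.sqrt 2 / 2)))
      (Eventually.of_forall fun r => ?_)).trans ?_
    · rw [norm_exp, shift_mul, add_re, re_ofReal_mul, om_re]
      apply Real.exp_le_exp.mpr
      have := re_expo_le ha hb r
      linarith
    · rw [integral_exp_neg_sq_add hβ]
      refine mul_le_mul ?_ ?_ (Real.exp_pos _).le (by norm_num)
      -- The Gaussian of rate `0.95π` costs the factor `1/√0.95 < 1.03`; the linear term contributes
      -- `π(2k+1)²/7.6`, as `7.6 = 8 · 0.95`.
      · rw [Real.sqrt_le_left (by norm_num), div_le_iff₀ hβ]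
        nlinarith
      · apply le_of_eq
        congr 1
        rw [div_eq_iff (by positivity)]
        linear_combination ((2 * k + 1) ^ 2 * Real.pi ^ 2 / 4 : ℝ) * hsq
  rw [h1, h2, one_mul]
  calc _ ≤ Real.exp (-((2 * k + 1) * Real.pi * (om * h).im)) *
        (1.03 * Real.exp (Real.pi * ((2 * k + 1) ^ 2 / 7.6))) := by gcongr
    _ = 1.03 * (Real.exp (Real.pi * ((2 * k + 1) ^ 2 / 7.6)) *
        Real.exp (-((2 * k + 1) * Real.pi * (om * h).im))) := by ring
    _ = _ := by
        rw [← Real.exp_add]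
        congr 2
        ring

theorem abs_pow_three_le_exp (r : ℝ) : |r| ^ 3 ≤ Real.exp (0.45 * Real.pi * r ^ 2) := by
  have h1 := Real.quadratic_le_exp_of_nonneg (show 0 ≤ 0.45 * Real.pi * r ^ 2 by positivity)
  have h2 : 1.35 ≤ 0.45 * Real.pi := by nlinarith [Real.pi_gt_three]
  have h3 : 1.35 * r ^ 2 ≤ 0.45 * Real.pi * r ^ 2 := by gcongr
  have h4 : (1.35 * r ^ 2) ^ 2 ≤ (0.45 * Real.pi * r ^ 2) ^ 2 := by gcongr
  have h5 : 0 ≤ |r| := abs_nonneg r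
  rw [← sq_abs r] at h3 h4 h1 ⊢
  nlinarith [sq_nonneg (|r| * (|r| - 1))]

theorem integral_main :
    ∫ r : ℝ, exp (-(2 * Real.pi * r ^ 2) + -(Real.pi * r) * om) =
      exp (Real.pi * I / 8) / Real.sqrt 2 := by
  have hpi : (Real.pi : ℂ) ≠ 0 := ofReal_ne_zero.mpr Real.pi_ne_zero
  have := integral_cexp_quadratic (b := -(2 * Real.pi))
    (by simpa using Real.pi_pos) (-(Real.pi * om)) 0
  rw [neg_neg, show (Real.pi / (2 * Real.pi) : ℂ) = ((1 / 2 : ℝ) : ℂ) by push_cast; field_simp,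
    show (1 / 2 : ℂ) = ((1 / 2 : ℝ) : ℂ) by push_cast; rfl, ← ofReal_cpow (by norm_num),
    ← Real.sqrt_eq_rpow, Real.sqrt_div (by norm_num), Real.sqrt_one] at this
  refine Eq.trans (integral_congr_ae (Eventually.of_forall fun r => ?_)) (this.trans ?_)
  · simp only
    congr 1
    ring
  · rw [show (0 - (-(Real.pi * om)) ^ 2 / (4 * -(2 * Real.pi)) : ℂ) = Real.pi * I / 8 by
      rw [neg_sq, mul_pow, om_sq]; field_simp; ring]
    push_cast
    ring

/-- The exponent is replaced by its quadratic part `-2πr²`, whose integral is explicit. In the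
error, `|r|³` is absorbed by `e^{0.45πr²}`, which leaves a Gaussian of rate `0.95π - 0.45π = π/2`.
-/
theorem vertGauss_saddle_zero {h : ℂ} (ha : 0 < h.re) (hb : h.im ^ 2 ≤ 0.18 * h.re ^ 2) :
    ∃ δ : ℂ, ‖δ‖ ≤ 2 * Real.pi / (3 * h.re) * (Real.sqrt 2 * Real.exp (Real.pi / 4)) ∧
      vertGauss h.re (2 * Real.pi * h ^ 2) (I * om / 2) =
        saddle h * (exp (-(Real.pi * I / 4)) * exp (Real.pi * I * (om * h))) *
          (exp (Real.pi * I / 8) / Real.sqrt 2 + δ) := by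
  have hpi := Real.pi_pos
  have hsq : Real.sqrt 2 ^ 2 = 2 := Real.sq_sqrt (by norm_num)
  have hβ : 0 < 0.95 * Real.pi := by positivity
  have hre : ∀ r : ℝ, (-(Real.pi * r) * om : ℂ).re = -(Real.pi * (Real.sqrt 2 / 2) * r) := by
    intro r
    rw [show (-(Real.pi * r) * om : ℂ) = ((-(Real.pi * r) : ℝ) : ℂ) * om by push_cast; ring,
      re_ofReal_mul, om_re]
    ring
  have hi1 : Integrable fun r : ℝ => exp (expo h r + -(Real.pi * r) * om) := by
    have := continuous_expo ha
    refine Integrable.mono' (integrable_exp_neg_sq_add hβ (Real.pi * (Real.sqrt 2 / 2)))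
      (Continuous.aestronglyMeasurable (by fun_prop)) (Eventually.of_forall fun r => ?_)
    rw [norm_exp, add_re, hre]
    apply Real.exp_le_exp.mpr
    have := re_expo_le ha hb r
    linarith
  have hi2 : Integrable fun r : ℝ => exp (-(2 * Real.pi * r ^ 2) + -(Real.pi * r) * om) := by
    have := integrable_cexp_quadratic (b := 2 * Real.pi)
      (by simpa using Real.pi_pos) (-(Real.pi * om)) 0
    refine this.congr (Eventually.of_forall fun r => ?_)
    simp only
    congr 1
    ring
  refine ⟨(∫ r : ℝ, exp (expo h r + -(Real.pi * r) * om)) -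
    ∫ r : ℝ, exp (-(2 * Real.pi * r ^ 2) + -(Real.pi * r) * om), ?_, ?_⟩
  · rw [← integral_sub hi1 hi2]
    have hβ' : 0 < Real.pi / 2 := by positivity
    have hval := integral_exp_neg_sq_add hβ' (Real.pi * (Real.sqrt 2 / 2))
    rw [show Real.pi / (Real.pi / 2) = 2 by field_simp,
      show (Real.pi * (Real.sqrt 2 / 2)) ^ 2 / (4 * (Real.pi / 2)) = Real.pi / 4 by
        rw [mul_pow, div_pow, hsq]; field_simp] at hval
    rw [← hval, ← integral_const_mul]
    refine norm_integral_le_of_norm_le ((integrable_exp_neg_sq_add hβ' _).const_mul _)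
      (Eventually.of_forall fun r => ?_)
    have h1 : (-(2 * Real.pi * r ^ 2) : ℂ).re ≤ -(0.95 * Real.pi) * r ^ 2 := by
      rw [show (-(2 * Real.pi * r ^ 2) : ℂ) = ((-(2 * Real.pi * r ^ 2) : ℝ) : ℂ) by push_cast; ring,
        ofReal_re]
      have : 0 ≤ Real.pi * r ^ 2 := by positivity
      nlinarith
    have h2 := norm_exp_sub_exp_le _ _ (re_expo_le ha hb r) h1
    have h3 := norm_expo_add_le ha r
    rw [exp_add, exp_add, ← sub_mul, norm_mul, norm_exp (_ * om), hre]
    rw [sub_neg_eq_add] at h2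
    calc _ ≤ (Real.exp (-(0.95 * Real.pi) * r ^ 2) * (2 * Real.pi / (3 * h.re) * |r| ^ 3)) *
          Real.exp (-(Real.pi * (Real.sqrt 2 / 2) * r)) := by
            gcongr
            exact h2.trans (by gcongr)
      _ ≤ (Real.exp (-(0.95 * Real.pi) * r ^ 2) * (2 * Real.pi / (3 * h.re) *
          Real.exp (0.45 * Real.pi * r ^ 2))) *
          Real.exp (-(Real.pi * (Real.sqrt 2 / 2) * r)) := by
            gcongr
            exact abs_pow_three_le_exp r
      _ = 2 * Real.pi / (3 * h.re) * (Real.exp (-(0.95 * Real.pi) * r ^ 2) *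
          Real.exp (0.45 * Real.pi * r ^ 2) * Real.exp (-(Real.pi * (Real.sqrt 2 / 2) * r))) := by ring
      _ = _ := by
          rw [← Real.exp_add, ← Real.exp_add]
          congr 2
          ring
  · rw [← integral_main, add_sub_cancel, vertGauss_eq_expo ha, ← saddle]
    have := exp_odd_shift h 0
    simp only [Nat.cast_zero, mul_zero, zero_add, one_mul] at this
    rw [this]
    congr 1
    refine integral_congr_ae (Eventually.of_forall fun r => ?_)
    simp only
    congr 2
    have := shift_mul 0 r
    simp only [Nat.cast_zero, mul_zero, zero_add, one_mul] at this
    rw [this]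
    push_cast
    ring

/-! ### Estimates on distant vertical lines -/

theorem cos_mul_exp_le {x : ℝ} (h1 : x ≤ Real.pi) :
    Real.cos x * Real.exp x ≤ Real.exp (Real.pi / 4) * (Real.sqrt 2 / 2) := by
  have hpi := Real.pi_pos
  -- On `x ≤ π` the maximum of `cos x · e^x` is at `π/4`, so the inequality is centred there.
  obtain ⟨d, rfl⟩ : ∃ d, x = Real.pi / 4 + d := ⟨x - Real.pi / 4, by ring⟩
  have key : (Real.cos d - Real.sin d) * Real.exp d ≤ 1 := by
    rcases le_or_gt d 0 with hd | hd
    · have h2 : -Real.sin d ≤ -d := by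
        rw [← Real.sin_neg]
        exact Real.sin_le (by linarith)
      calc (Real.cos d - Real.sin d) * Real.exp d ≤ (1 - d) * Real.exp d :=
            mul_le_mul_of_nonneg_right (by linarith [Real.cos_le_one d]) (Real.exp_pos d).le
        _ ≤ Real.exp (-d) * Real.exp d := by
            gcongr
            linarith [Real.add_one_le_exp (-d)]
        _ = 1 := by rw [← Real.exp_add, neg_add_cancel, Real.exp_zero]
    · have hder : ∀ t : ℝ, HasDerivAt (fun t => (Real.cos t - Real.sin t) * Real.exp t)
          (-(2 * Real.sin t * Real.exp t)) t := fun t =>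
        (((Real.hasDerivAt_cos t).sub (Real.hasDerivAt_sin t)).mul
          (Real.hasDerivAt_exp t)).congr_deriv (by simp only [Pi.sub_apply]; ring)
      have hanti : AntitoneOn (fun t => (Real.cos t - Real.sin t) * Real.exp t)
          (Icc 0 Real.pi) := by
        refine antitoneOn_of_hasDerivWithinAt_nonpos (convex_Icc 0 Real.pi)
          (fun t _ => (hder t).continuousAt.continuousWithinAt)
          (fun t _ => (hder t).hasDerivWithinAt) ?_
        intro t ht
        rw [interior_Icc] at ht
        have := Real.sin_pos_of_pos_of_lt_pi ht.1 ht.2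
        have := Real.exp_pos t
        rw [neg_nonpos]
        positivity
      have := hanti (left_mem_Icc.mpr hpi.le) (⟨hd.le, by linarith⟩ : d ∈ Icc 0 Real.pi) hd.le
      simpa using this
  rw [Real.cos_add, Real.cos_pi_div_four, Real.sin_pi_div_four, Real.exp_add]
  calc _ = Real.exp (Real.pi / 4) * (Real.sqrt 2 / 2) *
        ((Real.cos d - Real.sin d) * Real.exp d) := by ring
    _ ≤ _ := mul_le_of_le_one_right (by positivity) key

/-- Since `|Im w| ≤ Re w`, the power is at most `(e^{|arg z|}/|z|)^{Re w}`. With `|z| cos(arg z) =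
Re z`, this is governed by the maximum of `cos θ · e^θ`. -/
theorem norm_cpow_vert_le {w z : ℂ} (hz : 0 < z.re) (hw : |w.im| ≤ w.re) :
    ‖z ^ (-w)‖ ≤ (Real.exp (Real.pi / 4) * (Real.sqrt 2 / 2) / z.re) ^ w.re := by
  have hz0 : z ≠ 0 := by rintro rfl; simp at hz
  have hn : 0 < ‖z‖ := norm_pos_iff.mpr hz0
  have hw0 : 0 ≤ w.re := (abs_nonneg _).trans hw
  rw [norm_cpow_of_ne_zero hz0, div_eq_mul_inv, ← Real.exp_neg, neg_re, neg_im]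
  have h1 : -(z.arg * -w.im) ≤ |z.arg| * w.re := by
    calc -(z.arg * -w.im) = z.arg * w.im := by ring
      _ ≤ |z.arg * w.im| := le_abs_self _
      _ = |z.arg| * |w.im| := abs_mul _ _
      _ ≤ _ := by gcongr
  calc ‖z‖ ^ (-w.re) * Real.exp (-(z.arg * -w.im)) ≤ ‖z‖ ^ (-w.re) * Real.exp (|z.arg| * w.re) := by
        gcongr
    _ = (Real.exp |z.arg| / ‖z‖) ^ w.re := by
        rw [Real.div_rpow (Real.exp_pos _).le hn.le, Real.rpow_neg hn.le, Real.exp_mul]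
        ring
    _ ≤ _ := by
        apply Real.rpow_le_rpow (by positivity) _ hw0
        rw [div_le_div_iff₀ hn hz]
        have h2 := cos_mul_exp_le (abs_arg_le_pi z)
        rw [Real.cos_abs] at h2
        have h3 := norm_mul_cos_arg z
        calc Real.exp |z.arg| * z.re = (Real.cos z.arg * Real.exp |z.arg|) * ‖z‖ := by
              rw [← h3]; ring
          _ ≤ _ := by gcongr

/-- `πh² = w/2` gives the factor `e^{1/2}`; the remaining factor `e^{arg h · Im w}` is at least `1`,
because `arg h` and `Im w` have the same sign. -/
theorem norm_saddle_ge {h : ℂ} (ha : 0 < h.re) :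
    (Real.exp (1 / 2) / ‖h‖) ^ (2 * Real.pi * h ^ 2 : ℂ).re ≤ ‖saddle h‖ := by
  have hpi := Real.pi_pos
  have h0 : h ≠ 0 := by rintro rfl; simp at ha
  have hn : 0 < ‖h‖ := norm_pos_iff.mpr h0
  have hw : (2 * Real.pi * h ^ 2 : ℂ) = ((2 * Real.pi : ℝ) : ℂ) * h ^ 2 := by push_cast; ring
  have hre : (Real.pi * h ^ 2 : ℂ).re = (1 / 2) * (2 * Real.pi * h ^ 2 : ℂ).re := by
    rw [hw, re_ofReal_mul, re_ofReal_mul]; ring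
  have harg : 0 ≤ h.arg * (2 * Real.pi * h ^ 2 : ℂ).im := by
    rw [hw, im_ofReal_mul, pow_two, mul_im]
    rcases le_or_gt 0 h.im with hi | hi
    · have := arg_nonneg_iff.mpr hi
      positivity
    · have := arg_neg_iff.mpr hi
      have h3 : 2 * Real.pi * (h.re * h.im + h.im * h.re) ≤ 0 := by
        have : h.re * h.im ≤ 0 := mul_nonpos_of_nonneg_of_nonpos ha.le hi.le
        nlinarith
      exact mul_nonneg_of_nonpos_of_nonpos this.le h3
  rw [saddle, norm_mul, norm_cpow_of_ne_zero h0, norm_exp, hre, div_eq_mul_inv (‖h‖ ^ _),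
    ← Real.exp_neg, neg_re, neg_im, Real.exp_mul, Real.div_rpow (Real.exp_pos _).le hn.le,
    Real.rpow_neg hn.le]
  have h1 : 1 ≤ Real.exp (-(h.arg * -(2 * Real.pi * h ^ 2 : ℂ).im)) := by
    rw [Real.one_le_exp_iff]
    linarith
  rw [div_eq_mul_inv, mul_comm]
  refine mul_le_mul_of_nonneg_right ?_ (by positivity)
  exact le_mul_of_one_le_right (by positivity) h1

/-- The abscissa is `-Re α`, so the shifted Gaussian has modulus `e^{-π(r + Im α)²}`, of integral
one. Only the power is left, and it is compared with the lower bound for the saddle value. The bound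
is useful once `2k+1` exceeds about `2.66|h|`. -/
theorem norm_vertGauss_far_le {h : ℂ} (ha : 0 < h.re)
    (hs : |(2 * Real.pi * h ^ 2 : ℂ).im| ≤ (2 * Real.pi * h ^ 2 : ℂ).re) (k : ℕ) :
    ‖vertGauss ((2 * k + 1) * (Real.sqrt 2 / 4)) (2 * Real.pi * h ^ 2)
        ((2 * k + 1) * (I * om / 2))‖ ≤
      ‖saddle h‖ * (2 * Real.exp (Real.pi / 4 - 1 / 2) * ‖h‖ / (2 * k + 1)) ^
        (2 * Real.pi * h ^ 2 : ℂ).re := by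
  have hpi := Real.pi_pos
  have h0 : h ≠ 0 := by rintro rfl; simp at ha
  have hn : 0 < ‖h‖ := norm_pos_iff.mpr h0
  have hs2 : 0 < Real.sqrt 2 := by positivity
  set w : ℂ := 2 * Real.pi * h ^ 2 with hw
  set c : ℝ := (2 * k + 1) * (Real.sqrt 2 / 4) with hc
  have hcpos : 0 < c := by positivity
  have hα : ((2 * k + 1) * (I * om / 2) : ℂ) = (((2 * k + 1) / 2 : ℝ) : ℂ) * (I * om) := by
    push_cast; ring
  have hαre : ((2 * k + 1) * (I * om / 2) : ℂ).re = -c := by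
    rw [hα, re_ofReal_mul, I_mul_re, om_im, hc]; ring
  set A : ℝ := (Real.exp (Real.pi / 4) * (Real.sqrt 2 / 2) / c) ^ w.re with hA
  have hgi : Integrable fun r : ℝ => A * Real.exp (-Real.pi * (r +
      ((2 * k + 1) * (I * om / 2) : ℂ).im) ^ 2) :=
    ((integrable_exp_neg_mul_sq hpi).comp_add_right _).const_mul A
  have h1 : ‖vertGauss c w ((2 * k + 1) * (I * om / 2))‖ ≤ A := by
    refine (norm_integral_le_of_norm_le hgi (Eventually.of_forall fun r => ?_)).trans ?_
    · rw [norm_mul, norm_vertGauss_integrand, hαre, add_neg_cancel]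
      have hre : ((c : ℂ) + r * I).re = c := by simp
      have := norm_cpow_vert_le (w := w) (z := (c : ℂ) + r * I) (by rw [hre]; exact hcpos) hs
      rw [hre] at this
      simp only [ne_eq, OfNat.ofNat_ne_zero, not_false_eq_true, zero_pow, mul_zero, Real.exp_zero,
        one_mul]
      gcongr
    · rw [integral_const_mul, integral_add_right_eq_self
        (fun r : ℝ => Real.exp (-Real.pi * r ^ 2)), integral_gaussian, div_self hpi.ne',
        Real.sqrt_one, mul_one]
  refine h1.trans ?_
  calc A = (Real.exp (1 / 2) / ‖h‖) ^ w.re *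
        (2 * Real.exp (Real.pi / 4 - 1 / 2) * ‖h‖ / (2 * k + 1)) ^ w.re := by
        rw [← Real.mul_rpow (by positivity) (by positivity), hA]
        congr 1
        rw [Real.exp_sub, hc]
        field_simp
        norm_num
    _ ≤ _ := by
        gcongr
        exact norm_saddle_ge ha

/-! ### Numerical bounds in the sector -/

theorem im_sq_le_of_sector {a b : ℝ} (ha : 0 < a) (hs : |2 * (a * b)| ≤ a ^ 2 - b ^ 2) :
    b ^ 2 ≤ 0.18 * a ^ 2 := by
  rw [abs_mul, abs_mul, abs_two, abs_of_pos ha] at hs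
  rw [← sq_abs b] at hs ⊢
  have h0 := abs_nonneg b
  generalize |b| = β at *
  -- The constant `0.18` lies just above `tan²(π/8) = 0.1715…`.
  by_contra! hcon
  have : 0.42 * a < β := by
    by_contra! h
    nlinarith
  nlinarith

theorem sq_sub_sq_ge_of_sector {a b : ℝ} (hs : |2 * (a * b)| ≤ a ^ 2 - b ^ 2) :
    0.707 * (a ^ 2 + b ^ 2) ≤ a ^ 2 - b ^ 2 ∧ |2 * (a * b)| ≤ 0.7072 * (a ^ 2 + b ^ 2) := by
  have h0 := abs_nonneg (2 * (a * b))
  have hx : 0 ≤ a ^ 2 + b ^ 2 := by positivity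
  have hid : (a ^ 2 + b ^ 2) ^ 2 = (a ^ 2 - b ^ 2) ^ 2 + |2 * (a * b)| ^ 2 := by
    rw [sq_abs]; ring
  generalize a ^ 2 + b ^ 2 = x at *
  generalize a ^ 2 - b ^ 2 = z at *
  generalize |2 * (a * b)| = t at *
  -- Both constants are roundings of `cos(π/4) = sin(π/4) = 0.70710…`.
  constructor
  · by_contra! h
    nlinarith
  · by_contra! h
    nlinarith

/-- The points `h` with `|arg h| ≤ π/8` and `|h| ≥ 42`. -/
structure InSector (h : ℂ) : Prop where
  re_pos : 0 < h.re
  sector : |2 * (h.re * h.im)| ≤ h.re ^ 2 - h.im ^ 2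
  large : 42 ≤ ‖h‖

namespace InSector

theorem norm_sq_eq (h : ℂ) : ‖h‖ ^ 2 = h.re ^ 2 + h.im ^ 2 := by
  rw [← normSq_eq_norm_sq, normSq_apply]; ring

theorem two_pi_sq_re (h : ℂ) :
    (2 * Real.pi * h ^ 2 : ℂ).re = 2 * Real.pi * (h.re ^ 2 - h.im ^ 2) := by
  rw [show (2 * Real.pi * h ^ 2 : ℂ) = ((2 * Real.pi : ℝ) : ℂ) * h ^ 2 by push_cast; ring,
    re_ofReal_mul, pow_two, mul_re]
  ring

theorem two_pi_sq_im (h : ℂ) :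
    (2 * Real.pi * h ^ 2 : ℂ).im = 2 * Real.pi * (2 * (h.re * h.im)) := by
  rw [show (2 * Real.pi * h ^ 2 : ℂ) = ((2 * Real.pi : ℝ) : ℂ) * h ^ 2 by push_cast; ring,
    im_ofReal_mul, pow_two, mul_im]
  ring

theorem im_sq_eq (h : ℂ) : (om * h).im ^ 2 = (‖h‖ ^ 2 + 2 * (h.re * h.im)) / 2 := by
  rw [om_mul_im, mul_pow, div_pow, Real.sq_sqrt (by norm_num), norm_sq_eq]
  ring

theorem im_sq_le {h : ℂ} (H : InSector h) : h.im ^ 2 ≤ 0.18 * h.re ^ 2 := im_sq_le_of_sector H.re_pos H.sector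

theorem re_ge {h : ℂ} (H : InSector h) : 38 ≤ h.re := by
  have h1 := H.im_sq_le
  have h2 := H.large
  have h3 := norm_sq_eq h
  have := H.re_pos
  nlinarith

theorem abs_im_le {h : ℂ} (H : InSector h) : |(2 * Real.pi * h ^ 2 : ℂ).im| ≤ (2 * Real.pi * h ^ 2 : ℂ).re := by
  rw [two_pi_sq_im, two_pi_sq_re, abs_mul, abs_of_pos Real.two_pi_pos]
  have := H.sector
  have := Real.pi_pos
  gcongr

theorem exponent_ge {h : ℂ} (H : InSector h) : 4.44 * ‖h‖ ^ 2 ≤ (2 * Real.pi * h ^ 2 : ℂ).re := by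
  rw [two_pi_sq_re]
  have h1 := (sq_sub_sq_ge_of_sector H.sector).1
  rw [← norm_sq_eq] at h1
  have h2 := Real.pi_gt_d4
  calc 4.44 * ‖h‖ ^ 2 ≤ 2 * 3.1415 * (0.707 * ‖h‖ ^ 2) := by nlinarith [sq_nonneg ‖h‖]
    _ ≤ _ := by gcongr

theorem im_pos {h : ℂ} (H : InSector h) : 0 < (om * h).im := by
  rw [om_mul_im]
  have h1 := H.im_sq_le
  have h2 := H.re_pos
  have h3 : |h.im| < |h.re| := sq_lt_sq.mp (by nlinarith)
  rw [abs_of_pos h2, abs_lt] at h3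
  have : 0 < h.re + h.im := by linarith
  positivity

/-- `Im(ωh) = |h| sin(π/4 + arg h)` is at least `|h| sin(π/8)`, and `sin²(π/8) = 0.14644…`. -/
theorem im_sq_ge {h : ℂ} (H : InSector h) : 0.1464 * ‖h‖ ^ 2 ≤ (om * h).im ^ 2 := by
  have h1 := (sq_sub_sq_ge_of_sector H.sector).2
  rw [← norm_sq_eq, abs_le] at h1
  rw [im_sq_eq]
  linarith [h1.1]

theorem om_mul_im_le_norm (h : ℂ) : (om * h).im ≤ ‖h‖ := by
  have := Complex.im_le_norm (om * h)
  rwa [norm_mul, norm_om, one_mul] at this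

theorem im_ge {h : ℂ} (H : InSector h) : 16 ≤ (om * h).im := by
  have h1 := H.im_sq_ge
  have h2 := H.large
  have := H.im_pos
  nlinarith

theorem norm_le_im {h : ℂ} (H : InSector h) : ‖h‖ ≤ 2.6136 * (om * h).im := by
  have h1 := H.im_sq_ge
  have := H.im_pos
  have := norm_nonneg h
  by_contra! hc
  nlinarith

end InSector

theorem sq_le_exp_mul {x : ℝ} (hx : 16 ≤ x) : 1000 * x ^ 2 ≤ Real.exp (5.8 * x) := by
  have h := Real.pow_div_factorial_le_exp (5.8 * x) (by linarith) 4
  rw [show ((Nat.factorial 4 : ℕ) : ℝ) = 24 by norm_num [Nat.factorial]] at h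
  have h2 : (256 : ℝ) ≤ x ^ 2 := by nlinarith
  nlinarith [sq_nonneg x, mul_nonneg (sq_nonneg x) (by linarith : 0 ≤ x ^ 2 - 256)]

theorem near_bound {m y : ℝ} (hm : 3 ≤ m) (hy : 16 ≤ y) (hmy : m ≤ 7.32 * y) :
    1.03 * Real.exp (Real.pi * (m ^ 2 / 7.6 - m * y)) ≤
      Real.exp (-(Real.pi * y)) * (0.1 / m ^ 2) := by
  have hpi := Real.pi_gt_d2
  -- The left side is convex in `m`, hence controlled by its chord over `[3, 7.32y]`; the product in
  -- the next line expresses this. The surplus `1.88πy ≥ 5.8y` later absorbs the factor `m²`.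
  have h1 : m ^ 2 / 7.6 - m * y ≤ -y - 1.88 * y := by
    have h1 : (m - 3) * (m - 7.32 * y) ≤ 0 :=
      mul_nonpos_of_nonneg_of_nonpos (by linarith) (by linarith)
    have h2 : 0 ≤ m * (0.036 * y - 0.395) := mul_nonneg (by linarith) (by linarith)
    have h3 : 0 ≤ m * y := by positivity
    have h4 : m ^ 2 ≤ 7.6 * (m * y - 2.88 * y) := by linarith
    have h5 : m ^ 2 / 7.6 ≤ m * y - 2.88 * y := by
      rw [div_le_iff₀ (by norm_num)]
      linarith
    linarith
  have h2 : Real.pi * (m ^ 2 / 7.6 - m * y) ≤ -(Real.pi * y) + -(5.8 * y) := by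
    calc Real.pi * (m ^ 2 / 7.6 - m * y) ≤ Real.pi * (-y - 1.88 * y) := by gcongr
      _ ≤ _ := by nlinarith
  have h3 : 1.03 * Real.exp (-(5.8 * y)) ≤ 0.1 / m ^ 2 := by
    rw [Real.exp_neg, le_div_iff₀ (by positivity), ← div_eq_mul_inv, div_mul_eq_mul_div,
      div_le_iff₀ (Real.exp_pos _)]
    have := sq_le_exp_mul hy
    have : m ^ 2 ≤ (7.32 * y) ^ 2 := by gcongr
    nlinarith
  calc _ ≤ 1.03 * Real.exp (-(Real.pi * y) + -(5.8 * y)) := by gcongr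
    _ = Real.exp (-(Real.pi * y)) * (1.03 * Real.exp (-(5.8 * y))) := by rw [Real.exp_add]; ring
    _ ≤ _ := by gcongr

theorem two_mul_exp_le : 2 * Real.exp (Real.pi / 4 - 1 / 2) ≤ 2.662 := by
  have h1 : Real.pi / 4 - 1 / 2 ≤ 0.2854 := by linarith [Real.pi_lt_d4]
  have h2 : Real.exp (0.2854 : ℝ) ≤ 1.331 := by
    have := Real.exp_bound' (x := 0.2854) (by norm_num) (by norm_num) (n := 5) (by norm_num)
    refine this.trans ?_
    norm_num [Finset.sum_range_succ, Nat.factorial]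
  have := Real.exp_le_exp.mpr h1
  linarith

/-- The base is at most `2.662/2.8 < e^{-0.049}`. Two powers of it are set aside to supply `1/m²`.
The others must beat `(π + 5.8)N`, which needs roughly `0.049 · 4.44 N > 8.95`; this holds from `N =
42` on, with little to spare. -/
theorem far_bound {m y N W : ℝ} (hN : 42 ≤ N) (hy : y ≤ N) (hm : 2.8 * N ≤ m)
    (hW : 4.44 * N ^ 2 ≤ W) :
    (2 * Real.exp (Real.pi / 4 - 1 / 2) * N / m) ^ W ≤
      Real.exp (-(Real.pi * y)) * (0.1 / m ^ 2) := by
  have hm0 : 0 < m := by linarith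
  have hpi := Real.pi_lt_d2
  have hW2 : 0 ≤ W - 2 := by nlinarith
  set q := 2 * Real.exp (Real.pi / 4 - 1 / 2) * N / m with hq
  have hq0 : 0 < q := by positivity
  have hq1 : q ≤ 2.662 * N / m := by
    have := two_mul_exp_le
    rw [hq]; gcongr
  have hq2 : q ≤ Real.exp (-0.049) := by
    refine hq1.trans ?_
    rw [div_le_iff₀ hm0]
    have := Real.add_one_le_exp (-0.049 : ℝ)
    nlinarith
  have h1 : q ^ (W - 2) ≤ Real.exp (-(Real.pi * y)) * Real.exp (-(5.8 * N)) := by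
    calc q ^ (W - 2) ≤ Real.exp (-0.049) ^ (W - 2) := Real.rpow_le_rpow hq0.le hq2 hW2
      _ = Real.exp (-0.049 * (W - 2)) := (Real.exp_mul _ _).symm
      _ ≤ Real.exp (-(Real.pi * y) + -(5.8 * N)) := by
          apply Real.exp_le_exp.mpr
          have : Real.pi * y ≤ Real.pi * N := by
            have := Real.pi_pos
            gcongr
          nlinarith
      _ = _ := Real.exp_add _ _
  have h2 : q ^ 2 * Real.exp (-(5.8 * N)) ≤ 0.1 / m ^ 2 := by
    have := sq_le_exp_mul (show 16 ≤ N by linarith)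
    calc q ^ 2 * Real.exp (-(5.8 * N)) ≤ (2.662 * N / m) ^ 2 * Real.exp (-(5.8 * N)) := by gcongr
      _ = 2.662 ^ 2 * N ^ 2 / Real.exp (5.8 * N) / m ^ 2 := by rw [Real.exp_neg]; field_simp
      _ ≤ 0.1 / m ^ 2 := by
          gcongr
          rw [div_le_iff₀ (Real.exp_pos _)]
          nlinarith
  calc q ^ W = q ^ (W - 2) * q ^ 2 := by
        rw [← Real.rpow_two, ← Real.rpow_add hq0, sub_add_cancel]
    _ ≤ Real.exp (-(Real.pi * y)) * Real.exp (-(5.8 * N)) * q ^ 2 := by gcongr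
    _ = Real.exp (-(Real.pi * y)) * (q ^ 2 * Real.exp (-(5.8 * N))) := by ring
    _ ≤ _ := by gcongr

/-! ### Summation over the shifts -/

/-- No contour shift is needed: both sides, times the same nonzero factor, equal the Gaussian Mellin
integral, which does not involve the abscissa. -/
theorem vertGauss_eq_vertGauss {w : ℂ} (hw : 0 < w.re) (α : ℂ) {c c' : ℝ} (hc : 0 < c)
    (hc' : 0 < c') : vertGauss c w α = vertGauss c' w α := by
  have h1 := gaussMellin_eq_vertGauss hw α hc
  rw [gaussMellin_eq_vertGauss hw α hc'] at h1
  have h2 : (2 * Real.pi : ℂ) ^ (-w) ≠ 0 := by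
    rw [cpow_ne_zero_iff]
    left
    simp [Real.pi_ne_zero]
  exact (mul_left_cancel₀ (mul_ne_zero (Gamma_ne_zero_of_re_pos hw) h2) h1).symm

theorem norm_vertGauss_succ_le {h : ℂ} (H : InSector h) (k : ℕ) :
    ‖vertGauss h.re (2 * Real.pi * h ^ 2) ((2 * (k + 1 : ℕ) + 1) * (I * om / 2))‖ ≤
      ‖saddle h‖ * (Real.exp (-(Real.pi * (om * h).im)) * (0.1 / (2 * k + 3 : ℝ) ^ 2)) := by
  have hN := H.large
  have hm : (2 * (k + 1 : ℕ) + 1 : ℝ) = 2 * k + 3 := by push_cast; ring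
  have hk : (0 : ℝ) ≤ k := k.cast_nonneg
  -- The threshold `2.8` lies above `2.662`, as the far estimate requires, and `2.8 · 2.6136 < 7.32`
  -- meets the condition of the near one.
  rcases le_total (2 * k + 3 : ℝ) (2.8 * ‖h‖) with hle | hle
  · refine (norm_vertGauss_saddle_le H.re_pos H.im_sq_le (k + 1)).trans ?_
    rw [hm]
    refine mul_le_mul_of_nonneg_left ?_ (norm_nonneg _)
    refine near_bound (by linarith) H.im_ge ?_
    have := H.norm_le_im
    have := H.im_pos
    linarith
  · have hW := H.exponent_ge
    have hWpos : 0 < (2 * Real.pi * h ^ 2 : ℂ).re := by nlinarith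
    rw [vertGauss_eq_vertGauss hWpos _ H.re_pos
      (show 0 < (2 * (k + 1 : ℕ) + 1 : ℝ) * (Real.sqrt 2 / 4) by positivity)]
    refine (norm_vertGauss_far_le H.re_pos H.abs_im_le (k + 1)).trans ?_
    rw [hm]
    refine mul_le_mul_of_nonneg_left ?_ (norm_nonneg _)
    exact far_bound hN (InSector.om_mul_im_le_norm h) hle hW

theorem sum_inv_odd_sq_le (n : ℕ) :
    ∑ k ∈ Finset.range n, 0.1 / (2 * k + 3 : ℝ) ^ 2 ≤ 0.05 := by
  -- Telescoping: `1/(2k+3)²` is at most `1/((2k+1)(2k+3))`.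
  suffices h : ∑ k ∈ Finset.range n, 0.1 / (2 * k + 3 : ℝ) ^ 2 ≤ 0.05 - 0.05 / (2 * n + 1 : ℝ) by
    refine h.trans (sub_le_self _ (by positivity))
  induction n with
  | zero => norm_num
  | succ n ih =>
    rw [Finset.sum_range_succ]
    refine (add_le_add_left ih _).trans ?_
    have hn : (0 : ℝ) ≤ n := n.cast_nonneg
    have h1 : 0.05 / (2 * n + 1 : ℝ) - 0.05 / (2 * n + 3) = 0.1 / ((2 * n + 1) * (2 * n + 3)) := by
      field_simp
      ring
    have h2 : 0.1 / (2 * n + 3 : ℝ) ^ 2 ≤ 0.1 / ((2 * n + 1) * (2 * n + 3)) := by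
      gcongr
      nlinarith
    push_cast
    rw [show (2 * (n + 1) + 1 : ℝ) = 2 * n + 3 by ring]
    linarith

theorem norm_tsum_vertGauss_succ_le {h : ℂ} (H : InSector h) {S : ℂ}
    (hS : HasSum (fun k : ℕ => vertGauss h.re (2 * Real.pi * h ^ 2)
      ((2 * (k + 1 : ℕ) + 1) * (I * om / 2))) S) :
    ‖S‖ ≤ ‖saddle h‖ * (Real.exp (-(Real.pi * (om * h).im)) * 0.05) := by
  refine le_of_tendsto hS.tendsto_sum_nat.norm (Eventually.of_forall fun n => ?_)
  refine (norm_sum_le_of_le _ fun k _ => norm_vertGauss_succ_le H k).trans ?_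
  rw [← Finset.mul_sum, ← Finset.mul_sum]
  gcongr
  exact sum_inv_odd_sq_le n

theorem saddle_ne_zero {h : ℂ} (ha : 0 < h.re) : saddle h ≠ 0 := by
  have h0 : h ≠ 0 := by rintro rfl; simp at ha
  rw [saddle, cpow_def_of_ne_zero h0]
  exact mul_ne_zero (exp_ne_zero _) (exp_ne_zero _)

/-- The leading term in the asymptotic expansion of `(i/2) ∫₀^∞ y^{w-1} e^{-πy²}/sin(πe^{πi/4}y) dy`
for `w = 2πh²`. -/
def leading (h : ℂ) : ℂ :=
  Gamma (2 * Real.pi * h ^ 2) * (2 * Real.pi : ℂ) ^ (-(2 * Real.pi * h ^ 2)) * saddle h *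
    (exp (-(Real.pi * I / 8)) * exp (Real.pi * I * (om * h)) / Real.sqrt 2)

theorem leading_ne_zero {h : ℂ} (H : InSector h) : leading h ≠ 0 := by
  have hW := H.exponent_ge
  have hN := H.large
  have hWpos : 0 < (2 * Real.pi * h ^ 2 : ℂ).re := by nlinarith
  have h2 : (2 * Real.pi : ℂ) ^ (-(2 * Real.pi * h ^ 2)) ≠ 0 := by
    rw [cpow_ne_zero_iff]
    left
    simp [Real.pi_ne_zero]
  have h3 : (Real.sqrt 2 : ℂ) ≠ 0 := by simp
  exact mul_ne_zero (mul_ne_zero (mul_ne_zero (Gamma_ne_zero_of_re_pos hWpos) h2)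
    (saddle_ne_zero H.re_pos))
    (div_ne_zero (mul_ne_zero (exp_ne_zero _) (exp_ne_zero _)) h3)

theorem mellin_kern_eq_leading {h : ℂ} (H : InSector h) :
    ∃ δ : ℂ, ‖δ‖ ≤ 0.4 ∧ I / 2 * mellin kern (2 * Real.pi * h ^ 2) = leading h * (1 + δ) := by
  have hW := H.exponent_ge
  have hN := H.large
  have hW1 : 1 < (2 * Real.pi * h ^ 2 : ℂ).re := by nlinarith
  set w : ℂ := 2 * Real.pi * h ^ 2 with hw
  set G : ℂ := Gamma w * (2 * Real.pi : ℂ) ^ (-w) with hG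
  have hG0 : G ≠ 0 := by
    refine mul_ne_zero (Gamma_ne_zero_of_re_pos (by linarith)) ?_
    rw [cpow_ne_zero_iff]
    left
    simp [Real.pi_ne_zero]
  have hsum := hasSum_gaussMellin hW1
  simp_rw [gaussMellin_eq_vertGauss (show 0 < w.re by linarith) _ H.re_pos] at hsum
  have hsum' := hsum.mul_left G⁻¹
  simp_rw [← hG, inv_mul_cancel_left₀ hG0] at hsum'
  have htail := (hasSum_nat_add_iff' 1).mpr hsum'
  have hbound := norm_tsum_vertGauss_succ_le H htail
  set S := G⁻¹ * (I / 2 * mellin kern w) with hS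
  obtain ⟨δ, hδ, hV0⟩ := vertGauss_saddle_zero H.re_pos H.im_sq_le
  simp only [Finset.sum_range_one, Nat.cast_zero, mul_zero, zero_add, one_mul, ← hw] at hbound hV0
  rw [hV0] at hbound
  set u := exp (Real.pi * I * (om * h)) with hu
  have hu0 : u ≠ 0 := exp_ne_zero _
  have hunorm : ‖u‖ = Real.exp (-(Real.pi * (om * h).im)) := by
    rw [hu, norm_exp, mul_assoc, re_ofReal_mul, I_mul_re]
    ring_nf
  have hs0 := saddle_ne_zero H.re_pos
  have hr2 : (Real.sqrt 2 : ℂ) ≠ 0 := by simp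
  have hr2' : ‖(Real.sqrt 2 : ℂ)‖ = Real.sqrt 2 := by
    rw [norm_real, Real.norm_of_nonneg (Real.sqrt_nonneg _)]
  have e8 : exp (-(Real.pi * I / 8)) ≠ 0 := exp_ne_zero _
  have ne8 : ‖exp (-(Real.pi * I / 8))‖ = 1 := by
    rw [show (-(Real.pi * I / 8) : ℂ) = ((-(Real.pi / 8) : ℝ) : ℂ) * I by push_cast; ring,
      norm_exp_ofReal_mul_I]
  have e4 : exp (-(Real.pi * I / 4)) = exp (-(Real.pi * I / 8)) * exp (-(Real.pi * I / 8)) := by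
    rw [← exp_add]; congr 1; ring
  have e8' : exp (Real.pi * I / 8) = (exp (-(Real.pi * I / 8)))⁻¹ := by
    rw [← exp_neg, neg_neg]
  set z := exp (-(Real.pi * I / 8)) with hz
  set R := S - saddle h * (exp (-(Real.pi * I / 4)) * u) * (exp (Real.pi * I / 8) / Real.sqrt 2 + δ)
    with hR
  -- The first summand is the saddle point error of the term `k = 0`, at most `0.31`; the second is
  -- the sum over `k ≥ 1`, at most `0.08`. Both are taken relative to the leading term.
  refine ⟨Real.sqrt 2 * z * δ + R * Real.sqrt 2 / (saddle h * z * u), ?_, ?_⟩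
  · have h2 : ‖Real.sqrt 2 * z * δ‖ ≤ 0.31 := by
      rw [norm_mul, norm_mul, hr2', ne8, mul_one]
      have hpi := Real.pi_lt_d2
      have hpi0 := Real.pi_pos
      have hexp : Real.exp (Real.pi / 4) ≤ 2.7183 := by
        have h1 := Real.exp_one_lt_d9
        have h2 : Real.exp (Real.pi / 4) ≤ Real.exp 1 := Real.exp_le_exp.mpr (by linarith)
        linarith
      have hre := H.re_ge
      have hsq : Real.sqrt 2 * Real.sqrt 2 = 2 := Real.mul_self_sqrt (by norm_num)
      calc Real.sqrt 2 * ‖δ‖ ≤ Real.sqrt 2 *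
            (2 * Real.pi / (3 * h.re) * (Real.sqrt 2 * Real.exp (Real.pi / 4))) := by gcongr
        _ = 2 * Real.pi / (3 * h.re) * (Real.sqrt 2 * Real.sqrt 2) * Real.exp (Real.pi / 4) := by ring
        _ = 2 * Real.pi / (3 * h.re) * 2 * Real.exp (Real.pi / 4) := by rw [hsq]
        _ ≤ 2 * 3.15 / (3 * 38) * 2 * 2.7183 := by gcongr
        _ ≤ 0.31 := by norm_num
    have h3 : ‖R * Real.sqrt 2 / (saddle h * z * u)‖ ≤ 0.08 := by
      have hsp : 0 < ‖saddle h‖ := norm_pos_iff.mpr hs0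
      rw [norm_div, norm_mul, norm_mul, norm_mul, ne8, hr2', mul_one, hunorm,
        div_le_iff₀ (by positivity)]
      have hs15 : Real.sqrt 2 ≤ 1.5 := (Real.sqrt_le_left (by norm_num)).mpr (by norm_num)
      calc ‖R‖ * Real.sqrt 2 ≤
            ‖saddle h‖ * (Real.exp (-(Real.pi * (om * h).im)) * 0.05) * 1.5 := by gcongr
        _ = 0.075 * (‖saddle h‖ * Real.exp (-(Real.pi * (om * h).im))) := by ring
        _ ≤ _ := by gcongr; norm_num
    calc _ ≤ _ := norm_add_le _ _
      _ ≤ 0.4 := by linarith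
  · have hSG : I / 2 * mellin kern w = G * S := by
      rw [hS, mul_inv_cancel_left₀ hG0]
    rw [hSG, leading, ← hw, ← hG, ← hu, ← hz]
    have : S = R + saddle h * (exp (-(Real.pi * I / 4)) * u) *
        (exp (Real.pi * I / 8) / Real.sqrt 2 + δ) := by rw [hR]; ring
    rw [this, e4, e8']
    field_simp
    ring

/-! ### Return to the variable `s` -/

/-- The principal square root of `(1-s)/(2π)`, so that `η(s) = e^{πi/4} root s`. -/
def root (s : ℂ) : ℂ := ((1 - s) / (2 * Real.pi)) ^ (1 / 2 : ℂ)

theorem eta_eq (s : ℂ) : eta s = om * root s := rfl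

theorem root_sq (s : ℂ) : root s ^ 2 = (1 - s) / (2 * Real.pi) := by
  rw [root, one_div]
  exact cpow_nat_inv_pow _ two_ne_zero

theorem two_pi_mul_root_sq (s : ℂ) : 2 * Real.pi * root s ^ 2 = 1 - s := by
  have hpi : (Real.pi : ℂ) ≠ 0 := ofReal_ne_zero.mpr Real.pi_ne_zero
  rw [root_sq]
  field_simp

theorem re_pos_of_mem_region {s : ℂ} (hs : s ∈ region) : 0 < 1 - s.re :=
  (abs_nonneg _).trans_lt hs.1

theorem div_two_pi_re_pos {s : ℂ} (hs : s ∈ region) : 0 < ((1 - s) / (2 * Real.pi)).re := by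
  have h := re_pos_of_mem_region hs
  rw [show (1 - s) / (2 * Real.pi) = (1 - s) / ((2 * Real.pi : ℝ) : ℂ) by push_cast; rfl,
    div_ofReal_re, sub_re, one_re]
  have := Real.pi_pos
  positivity

theorem root_re_pos {s : ℂ} (hs : s ∈ region) : 0 < (root s).re := by
  have h := div_two_pi_re_pos hs
  have h0 : (1 - s) / (2 * Real.pi) ≠ 0 := by
    intro h'
    rw [h'] at h
    simp at h
  have harg := abs_arg_lt_pi_div_two_iff.mpr (Or.inl h)
  rw [abs_lt] at harg
  rw [root, cpow_def_of_ne_zero h0, exp_re]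
  refine mul_pos (Real.exp_pos _) (Real.cos_pos_of_mem_Ioo ?_)
  rw [show (log ((1 - s) / (2 * Real.pi)) * (1 / 2)).im = ((1 - s) / (2 * Real.pi)).arg / 2 by
    rw [show (1 / 2 : ℂ) = ((1 / 2 : ℝ) : ℂ) by push_cast; rfl, im_mul_ofReal, log_im]; ring]
  have := Real.pi_pos
  constructor <;> linarith

/-- `1 - σ > |t|` means `|arg(1-s)| < π/4`, which the square root halves; and `3528π = 2π · 42²`. -/
theorem inSector_root {s : ℂ} (hs : s ∈ region) : InSector (root s) := by
  have hpi := Real.pi_pos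
  refine ⟨root_re_pos hs, ?_, ?_⟩
  · have h1 := InSector.two_pi_sq_re (root s)
    have h2 := InSector.two_pi_sq_im (root s)
    rw [two_pi_mul_root_sq, sub_re, one_re] at h1
    rw [two_pi_mul_root_sq, sub_im, one_im, zero_sub] at h2
    have h3 := hs.1
    rw [h1, ← abs_neg, h2, abs_mul, abs_of_pos Real.two_pi_pos] at h3
    exact (lt_of_mul_lt_mul_left h3 Real.two_pi_pos.le).le
  · have h1 : 2 * Real.pi * ‖root s‖ ^ 2 = ‖s - 1‖ := by
      rw [norm_sub_rev, ← two_pi_mul_root_sq, norm_mul, norm_pow,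
        show (2 * Real.pi : ℂ) = ((2 * Real.pi : ℝ) : ℂ) by push_cast; rfl, norm_real,
        Real.norm_of_nonneg Real.two_pi_pos.le]
    have h2 := hs.2
    rw [← h1] at h2
    have h3 : 42 ^ 2 ≤ ‖root s‖ ^ 2 := by
      by_contra! h
      nlinarith
    exact le_of_sq_le_sq h3 (norm_nonneg _)

theorem re_lt_of_mem_region {s : ℂ} (hs : s ∈ region) : s.re < -1 := by
  have h := (inSector_root hs).exponent_ge
  have h2 := (inSector_root hs).large
  rw [two_pi_mul_root_sq, sub_re, one_re] at h
  nlinarith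

theorem continuousAt_root {s : ℂ} (hs : s ∈ region) : ContinuousAt root s := by
  refine ContinuousAt.cpow (by fun_prop) continuousAt_const ?_
  exact Or.inl (div_two_pi_re_pos hs)

theorem norm_sin_om_ge {y : ℝ} (hy : 0 < y) : y ≤ ‖sin (Real.pi * om * y)‖ := by
  have hpi := Real.pi_gt_three
  have hre : (Real.pi * om * y * I : ℂ).re = -(Real.pi * y * (Real.sqrt 2 / 2)) := by
    rw [show (Real.pi * om * y * I : ℂ) = ((Real.pi * y : ℝ) : ℂ) * (I * om) by push_cast; ring,
      re_ofReal_mul, I_mul_re, om_im]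
    ring
  have hb : y ≤ Real.pi * y * (Real.sqrt 2 / 2) := by
    have h1 : 1 ≤ Real.sqrt 2 := Real.one_le_sqrt.mpr (by norm_num)
    nlinarith [mul_le_mul_of_nonneg_left h1 (by positivity : 0 ≤ Real.pi * y)]
  have h2 := norm_sub_norm_le (exp (-(Real.pi * om * y) * I)) (exp (Real.pi * om * y * I))
  rw [norm_exp, norm_exp, neg_mul, neg_re, hre, neg_neg] at h2
  have h3 := Real.self_le_sinh_iff.mpr (hy.le.trans hb)
  rw [Real.sinh_eq] at h3
  rw [sin, norm_div, norm_mul, norm_I, mul_one, Complex.norm_two, neg_mul]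
  linarith

theorem sin_ne_zero_of_pos {y : ℝ} (hy : 0 < y) : sin (Real.pi * om * y) ≠ 0 :=
  norm_pos_iff.mp (hy.trans_le (norm_sin_om_ge hy))

/-- The kernel is `O(1/y)` at `0` and decays exponentially at infinity, so its Mellin transform is
holomorphic for `Re w > 1`. -/
theorem continuousAt_mellin_kern {w : ℂ} (hw : 1 < w.re) : ContinuousAt (mellin kern) w := by
  have hpi := Real.pi_pos
  have hnorm : ∀ y : ℝ, 0 < y → ‖kern y‖ ≤ Real.exp (-(Real.pi * y ^ 2)) * y⁻¹ := by
    intro y hy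
    have h := norm_sin_om_ge hy
    rw [kern, norm_div, norm_exp, show (-(Real.pi * (y : ℂ) ^ 2) : ℂ) =
      ((-(Real.pi * y ^ 2) : ℝ) : ℂ) by push_cast; rfl, ofReal_re, div_eq_mul_inv]
    gcongr
  refine (mellin_differentiableAt_of_isBigO_rpow_exp (a := 1) (b := 1) one_pos ?_ ?_ ?_ hw).continuousAt
  · refine ContinuousOn.locallyIntegrableOn ?_ measurableSet_Ioi
    intro y hy
    have : ContinuousAt kern y := by
      unfold kern
      exact ContinuousAt.div (by fun_prop) (by fun_prop) (sin_ne_zero_of_pos hy)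
    exact this.continuousWithinAt
  · refine Asymptotics.IsBigO.of_bound 1 ?_
    filter_upwards [eventually_ge_atTop (1 : ℝ)] with y hy
    rw [one_mul, Real.norm_of_nonneg (Real.exp_pos _).le]
    refine (hnorm y (by linarith)).trans ?_
    calc _ ≤ Real.exp (-1 * y) * 1 := by
          gcongr
          · nlinarith [Real.pi_gt_three]
          · exact inv_le_one_of_one_le₀ hy
      _ = _ := mul_one _
  · refine Asymptotics.IsBigO.of_bound 1 ?_
    filter_upwards [self_mem_nhdsWithin] with y hy
    have hy : 0 < y := hy
    rw [one_mul, Real.rpow_neg_one, Real.norm_of_nonneg (by positivity)]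
    refine (hnorm y hy).trans (mul_le_of_le_one_left (by positivity) ?_)
    rw [Real.exp_le_one_iff, neg_nonpos]
    positivity

theorem continuousAt_leading {h : ℂ} (H : InSector h) : ContinuousAt leading h := by
  have hW := H.exponent_ge
  have hN := H.large
  have hWpos : 0 < (2 * Real.pi * h ^ 2 : ℂ).re := by nlinarith
  have hG : ContinuousAt (fun h : ℂ => Gamma (2 * Real.pi * h ^ 2)) h := by
    refine ContinuousAt.comp (g := Gamma) (f := fun h : ℂ => 2 * Real.pi * h ^ 2) ?_ (by fun_prop)
    refine (differentiableAt_Gamma _ fun m hm => ?_).continuousAt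
    rw [hm] at hWpos
    simp at hWpos
    linarith [(m.cast_nonneg : (0 : ℝ) ≤ m)]
  have hp : ContinuousAt (fun h : ℂ => (2 * Real.pi : ℂ) ^ (-(2 * Real.pi * h ^ 2))) h := by
    refine ContinuousAt.const_cpow (by fun_prop) (Or.inl ?_)
    simp [Real.pi_ne_zero]
  have hs : ContinuousAt saddle h := by
    unfold saddle
    refine ContinuousAt.mul (ContinuousAt.cpow continuousAt_id (by fun_prop) ?_) (by fun_prop)
    exact Or.inl H.re_pos
  unfold leading
  exact ((hG.mul hp).mul hs).mul (by fun_prop)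

/-! ### The relative error and the zeros -/

/-- The relative error of the main term. -/
def relErr (s : ℂ) : ℂ :=
  I / 2 * mellin kern (1 - s) / leading (root s) *
    ((1 + exp (Real.pi * I * eta s) ^ 4) / (1 - exp (Real.pi * I * eta s) ^ 2)) - 1

theorem norm_exp_eta_sq_le {s : ℂ} (hs : s ∈ region) : ‖exp (Real.pi * I * eta s) ^ 2‖ ≤ 0.02 := by
  have h := (inSector_root hs).im_ge
  have hpi := Real.pi_gt_three
  rw [← exp_nat_mul, norm_exp, eta_eq, show (((2 : ℕ) : ℂ) * (Real.pi * I * (om * root s)) : ℂ) =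
    ((2 * Real.pi : ℝ) : ℂ) * (I * (om * root s)) by push_cast; ring, re_ofReal_mul, I_mul_re,
    mul_neg, Real.exp_neg]
  have h1 := Real.add_one_le_exp (2 * Real.pi * (om * root s).im)
  rw [inv_le_comm₀ (Real.exp_pos _) (by norm_num)]
  nlinarith

theorem one_sub_exp_ne_zero {s : ℂ} (hs : s ∈ region) : 1 - exp (Real.pi * I * eta s) ^ 2 ≠ 0 := by
  have h := norm_exp_eta_sq_le hs
  intro h0
  rw [← sub_eq_zero.mp h0] at h
  norm_num at h

theorem one_add_exp_ne_zero {s : ℂ} (hs : s ∈ region) : 1 + exp (Real.pi * I * eta s) ^ 4 ≠ 0 := by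
  have h := norm_exp_eta_sq_le hs
  intro h0
  have h1 : exp (Real.pi * I * eta s) ^ 2 * exp (Real.pi * I * eta s) ^ 2 = -1 := by
    linear_combination h0
  have h2 := congrArg norm h1
  rw [norm_mul, norm_neg, norm_one] at h2
  nlinarith [norm_nonneg (exp (Real.pi * I * eta s) ^ 2)]

/-- With `e = e^{2πiη}` the error is `(δ(1+e²) + e² + e)/(1-e)`, where `|δ| ≤ 0.4` and `|e| ≤ 0.02`.
-/
theorem norm_relErr_lt {s : ℂ} (hs : s ∈ region) : ‖relErr s‖ < 1 := by
  obtain ⟨δ, hδ, heq⟩ := mellin_kern_eq_leading (inSector_root hs)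
  rw [two_pi_mul_root_sq] at heq
  have hE := norm_exp_eta_sq_le hs
  have h1 := one_sub_exp_ne_zero hs
  have hl := leading_ne_zero (inSector_root hs)
  have hE4 : exp (Real.pi * I * eta s) ^ 4 =
    exp (Real.pi * I * eta s) ^ 2 * exp (Real.pi * I * eta s) ^ 2 := by ring
  rw [relErr, heq, mul_div_cancel_left₀ _ hl, hE4]
  generalize exp (Real.pi * I * eta s) ^ 2 = e at *
  rw [show (1 + δ) * ((1 + e * e) / (1 - e)) - 1 = (δ * (1 + e * e) + e * e + e) / (1 - e) by
    field_simp; ring, norm_div, div_lt_one (norm_pos_iff.mpr h1)]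
  have h2 : 0.98 ≤ ‖1 - e‖ := by
    have := norm_sub_norm_le (1 : ℂ) e
    rw [norm_one] at this
    linarith
  have hee : ‖e * e‖ ≤ 0.0004 := by
    rw [norm_mul]; nlinarith [norm_nonneg e]
  have h3 : ‖δ * (1 + e * e)‖ ≤ 0.4 * 1.0004 := by
    rw [norm_mul]
    have : ‖1 + e * e‖ ≤ 1.0004 := by
      have := norm_add_le (1 : ℂ) (e * e)
      rw [norm_one] at this
      linarith
    gcongr
  have h4 := norm_add₃_le (a := δ * (1 + e * e)) (b := e * e) (c := e)
  linarith

/-- The common factor `sin(πs/2)` of `R` and of the main term has been cancelled in `relErr`, so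
every denominator is nonzero, even at the points `s = -2n`. -/
theorem continuousOn_relErr : ContinuousOn relErr region := by
  intro s hs
  refine ContinuousAt.continuousWithinAt ?_
  have hr := continuousAt_root hs
  have hm : ContinuousAt (fun s : ℂ => mellin kern (1 - s)) s := by
    refine ContinuousAt.comp (g := mellin kern) (f := fun s : ℂ => 1 - s) ?_ (by fun_prop)
    refine continuousAt_mellin_kern ?_
    have := re_lt_of_mem_region hs
    rw [sub_re, one_re]
    linarith
  have hl : ContinuousAt (fun s : ℂ => leading (root s)) s :=
    ContinuousAt.comp (g := leading) (continuousAt_leading (inSector_root hs)) hr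
  have he : ContinuousAt eta s := hr.const_mul om
  unfold relErr
  exact (((hm.const_mul _).div hl (leading_ne_zero (inSector_root hs))).mul
    (ContinuousAt.div (by fun_prop) (by fun_prop) (one_sub_exp_ne_zero hs))).sub continuousAt_const

theorem log_om_mul {h : ℂ} (hh : 0 < h.re) : log (om * h) = Real.pi * I / 4 + log h := by
  have h0 : h ≠ 0 := by rintro rfl; simp at hh
  have harg := abs_arg_lt_pi_div_two_iff.mpr (Or.inl hh)
  rw [abs_lt] at harg
  have hpi := Real.pi_pos
  have him : (Real.pi * I / 4 + log h).im = Real.pi / 4 + h.arg := by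
    rw [add_im, log_im, show (Real.pi * I / 4 : ℂ) = ((Real.pi / 4 : ℝ) : ℂ) * I by push_cast; ring,
      im_ofReal_mul, I_im, mul_one]
  rw [← log_exp (x := Real.pi * I / 4 + log h) (by rw [him]; linarith) (by rw [him]; linarith),
    exp_add, exp_log h0, om]

theorem sin_div_cos_eq {z : ℂ} (h1 : 1 + exp (Real.pi * I * z) ^ 4 ≠ 0) :
    sin (Real.pi * z) / (2 * cos (2 * Real.pi * z)) =
      I / 2 * exp (Real.pi * I * z) * (1 - exp (Real.pi * I * z) ^ 2) /
        (1 + exp (Real.pi * I * z) ^ 4) := by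
  have hu0 := exp_ne_zero (Real.pi * I * z)
  have hsin : sin (Real.pi * z) = ((exp (Real.pi * I * z))⁻¹ - exp (Real.pi * I * z)) * I / 2 := by
    rw [sin, ← exp_neg]
    ring_nf
  have hcos : cos (2 * Real.pi * z) =
      (exp (Real.pi * I * z) ^ 2 + (exp (Real.pi * I * z) ^ 2)⁻¹) / 2 := by
    rw [cos, ← exp_nat_mul, ← exp_neg]
    push_cast
    ring_nf
  rw [hsin, hcos]
  generalize exp (Real.pi * I * z) = u at *
  have h2 : u ^ 2 + (u ^ 2)⁻¹ = (1 + u ^ 4) * (u ^ 2)⁻¹ := by field_simp; ring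
  rw [h2]
  field_simp

theorem chi_eq (s : ℂ) : chi s = 2 * (2 * Real.pi : ℂ) ^ (-(1 - s)) * sin (Real.pi * s / 2) *
    Gamma (1 - s) := by
  have h2 : (2 * Real.pi : ℂ) ^ (-(1 - s)) = 2 ^ (s - 1) * (Real.pi : ℂ) ^ (s - 1) := by
    have := mul_cpow_ofReal_nonneg (a := 2) (b := Real.pi) (by norm_num) Real.pi_pos.le (s - 1)
    rw [neg_sub]
    simpa using this
  rw [chi, h2, cpow_sub _ _ two_ne_zero, cpow_one]
  field_simp

theorem auxR_eq_mainTerm_mul {s : ℂ} (hs : s ∈ region) :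
    auxR s = mainTerm s * (1 + relErr s) := by
  have hh := root_re_pos hs
  have h0 : root s ≠ 0 := by intro h; rw [h] at hh; simp at hh
  have hl := leading_ne_zero (inSector_root hs)
  have hp := one_add_exp_ne_zero hs
  have hm := one_sub_exp_ne_zero hs
  have hw := two_pi_mul_root_sq s
  have hpow : eta s ^ (s - 1) = exp (-(Real.pi * I * (1 - s) / 4)) * root s ^ (-(1 - s)) := by
    rw [eta_eq, cpow_def_of_ne_zero (mul_ne_zero om_ne_zero h0), cpow_def_of_ne_zero h0,
      log_om_mul hh, ← exp_add]
    ring_nf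
  have hsq : -(Real.pi * I * eta s ^ 2) = Real.pi * root s ^ 2 := by
    rw [eta_eq, mul_pow, om_sq]
    linear_combination (-(Real.pi * root s ^ 2) : ℂ) * I_sq
  have hphase : exp (Real.pi * I * (s + 1) / 4) = I * exp (-(Real.pi * I * (1 - s) / 4)) := by
    rw [show (Real.pi * I * (s + 1) / 4 : ℂ) =
      Real.pi / 2 * I + -(Real.pi * I * (1 - s) / 4) by ring, exp_add, exp_pi_div_two_mul_I]
  have h38 : exp (3 * Real.pi * I / 8) = I * exp (-(Real.pi * I / 8)) := by
    rw [show (3 * Real.pi * I / 8 : ℂ) = Real.pi / 2 * I + -(Real.pi * I / 8) by ring, exp_add,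
      exp_pi_div_two_mul_I]
  have hr2 : (Real.sqrt 2 : ℂ) * Real.sqrt 2 = 2 := by
    exact_mod_cast Real.mul_self_sqrt (show (0 : ℝ) ≤ 2 by norm_num)
  have hr2' : (Real.sqrt 2 : ℂ) ≠ 0 := by simp
  rw [auxR_eq_mellin (re_lt_of_mem_region hs), mainTerm, relErr, chi_eq, hpow, hsq, hphase, h38,
    mul_div_assoc (((Real.sqrt 2 : ℝ) : ℂ) * _), sin_div_cos_eq hp]
  have hlead : leading (root s) = Gamma (1 - s) * (2 * Real.pi : ℂ) ^ (-(1 - s)) *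
      (root s ^ (-(1 - s)) * exp (Real.pi * root s ^ 2)) *
      (exp (-(Real.pi * I / 8)) * exp (Real.pi * I * eta s) / Real.sqrt 2) := by
    rw [leading, saddle, hw, eta_eq]
  -- Once the phases are matched, only a rational identity in the separate factors remains. It does
  -- not divide by `c`, the value of `sin(πs/2)`, which may be zero.
  have hkey : ∀ a b c d e g u r z M : ℂ, r ≠ 0 → r * r = 2 → 1 + u ^ 4 ≠ 0 → 1 - u ^ 2 ≠ 0 →
      g * b * (d * e) * (z * u / r) ≠ 0 →
      I * a * c * M = -(2 * b * c * g) * (a * d) * e *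
        (r * (I * z) * (I / 2 * u * (1 - u ^ 2) / (1 + u ^ 4))) *
        (1 + (I / 2 * M / (g * b * (d * e) * (z * u / r)) * ((1 + u ^ 4) / (1 - u ^ 2)) - 1)) := by
    intro a b c d e g u r z M hr hrr hu4 hu2 hne
    have hg : g ≠ 0 := by rintro rfl; simp at hne
    have hb : b ≠ 0 := by rintro rfl; simp at hne
    have hd : d ≠ 0 := by rintro rfl; simp at hne
    have he : e ≠ 0 := by rintro rfl; simp at hne
    have hz : z ≠ 0 := by rintro rfl; simp at hne
    have hu : u ≠ 0 := by rintro rfl; simp at hne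
    rw [add_sub_cancel]
    field_simp
    rw [show r ^ 2 = 2 by rw [pow_two, hrr], I_sq]
    ring
  rw [hlead]
  exact hkey _ _ _ _ _ _ _ _ _ _ hr2' hr2 hp hm (hlead ▸ hl)

/-- For `Re s < -1` the Gamma factor is finite and nonzero, so only the sine can vanish, and it does
so at the even integers. -/
theorem chi_eq_zero_iff {s : ℂ} (hs : s ∈ region) : chi s = 0 ↔ ∃ n : ℕ, 0 < n ∧ s = -2 * (n : ℂ) := by
  have hpi : (Real.pi : ℂ) ≠ 0 := ofReal_ne_zero.mpr Real.pi_ne_zero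
  have hre := re_lt_of_mem_region hs
  have hG : Gamma (1 - s) ≠ 0 := by
    refine Gamma_ne_zero_of_re_pos ?_
    rw [sub_re, one_re]
    linarith
  have h2 : (2 * Real.pi : ℂ) ^ (-(1 - s)) ≠ 0 := by
    rw [cpow_ne_zero_iff]
    left
    simp [hpi]
  rw [chi_eq, mul_eq_zero, or_iff_left hG, mul_eq_zero, or_iff_right (mul_ne_zero two_ne_zero h2),
    sin_eq_zero_iff]
  constructor
  · rintro ⟨k, hk⟩
    have hsk : s = 2 * k := by
      apply mul_left_cancel₀ hpi
      linear_combination 2 * hk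
    have hk0 : k < 0 := by
      rw [hsk] at hre
      have : (2 * (k : ℂ)).re = 2 * (k : ℝ) := by simp
      rw [this] at hre
      have : (k : ℝ) < 0 := by linarith
      exact_mod_cast this
    refine ⟨k.natAbs, by omega, ?_⟩
    rw [hsk, Nat.cast_natAbs, abs_of_neg hk0]
    push_cast
    ring
  · rintro ⟨n, _, rfl⟩
    refine ⟨-n, ?_⟩
    push_cast
    ring

theorem mainTerm_eq_zero_iff {s : ℂ} (hs : s ∈ region) : mainTerm s = 0 ↔ chi s = 0 := by
  have h0 : eta s ≠ 0 := by
    intro h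
    have h1 := (inSector_root hs).im_pos
    rw [← eta_eq, h] at h1
    simp at h1
  have hpow : eta s ^ (s - 1) ≠ 0 := by
    rw [cpow_ne_zero_iff]
    exact Or.inl h0
  have hs2 : ((Real.sqrt 2 : ℝ) : ℂ) ≠ 0 := by simp
  rw [mainTerm, mul_div_assoc, sin_div_cos_eq (one_add_exp_ne_zero hs)]
  simp [hpow, one_add_exp_ne_zero hs, one_sub_exp_ne_zero hs]

end RiemannAux

end

theorem mainTheorem5 :
    (∀ s ∈ RiemannAux.region,
      RiemannAux.auxR s = 0 ↔ ∃ n : ℕ, 0 < n ∧ s = -2 * (n : ℂ)) ∧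
    ∃ U : ℂ → ℂ, ContinuousOn U RiemannAux.region ∧
      ∀ s ∈ RiemannAux.region,
        RiemannAux.auxR s = RiemannAux.mainTerm s * (1 + U s) ∧ ‖U s‖ < 1 := by
  refine ⟨fun s hs => ?_, RiemannAux.relErr, RiemannAux.continuousOn_relErr, fun s hs =>
    ⟨RiemannAux.auxR_eq_mainTerm_mul hs, RiemannAux.norm_relErr_lt hs⟩⟩
  have h1 : 1 + RiemannAux.relErr s ≠ 0 := by
    intro h
    have h2 := RiemannAux.norm_relErr_lt hs
    rw [eq_neg_of_add_eq_zero_right h, norm_neg, norm_one] at h2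
    exact lt_irrefl _ h2
  rw [RiemannAux.auxR_eq_mainTerm_mul hs, mul_eq_zero, or_iff_left h1,
    RiemannAux.mainTerm_eq_zero_iff hs, RiemannAux.chi_eq_zero_iff hs]
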